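/- Let $d\ge 1$ and let $$K(v,w)=\int_{\{y\in\mathbb R^d:\ |y|^d\le d\,\Gamma(d/2)/(2\pi^{1+d/2})\}}\exp\bigl(2\pi i\,(v-w)\cdot y\bigr)\,\mathrm dy,\qquad v,w\in\mathbb R^d,$$ be the kernel of the stationary determinantal point process on $\mathbb R^d$ (with Lebesgue measure as reference measure) for which the Fourier transform of $K(\cdot,0)$ is the indicator function of the centred ball of volume $1/\pi$. This process has intensity $K(u,u)=1/\pi$ and is globally most repulsive, that is, $\int_{\mathbb R^d}|K(v,u)|^2/K(u,u)\,\mathrm dv=1$ for every $u\in\mathbb R^d$. For every $u\in\mathbb R^d$, the function $$\rho_u(v)=\frac{|K(v,u)|^2}{K(u,u)}=\pi|K(u,v)|^2,\qquad v\in\mathbb R^d,$$ is a probability density function on $\mathbb R^d$. In particular, for $d=2$ and every $u\in\mathbb R^2$, $$\rho_u(v)=\frac{J_1(2|v-u|)^2}{\pi|v-u|^2},\qquad v\in\mathbb R^2\setminus\{u\},\qquad \rho_u(u)=\frac1\pi,$$ where $J_1(x)=\sum_{m\ge0}\frac{(-1)^m}{m!\,(m+1)!}(x/2)^{2m+1}$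 is the Bessel function of the first kind of order one; and if $Z_u$ is a random variable in $\mathbb R^2$ with density $\rho_u$, then for every real $k\in(-2,1)$ the $k$-th moment of $|Z_u-u|$ is finite and $$\mathrm E\bigl(|Z_u-u|^k\bigr)=\frac{\Gamma(1+k/2)\,\Gamma(1-k)}{\Gamma(2-k/2)\,\Gamma(1-k/2)^2},$$ while $\mathrm E\bigl(|Z_u-u|^k\bigr)=\infty$ for every real $k\ge1$. -/

import Mathlib

open MeasureTheory

/-- The Bessel function of the first kind `J_n` of integer order `n ≥ 0` on the real line:
`J_n(x) = ∑ₘ (-1)ᵐ / (m! (m+n)!) (x/2)^(2m+n)` (an everywhere absolutely convergent series). -/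
noncomputable def besselJ (n : ℕ) (x : ℝ) : ℝ :=
  ∑' m : ℕ, (-1 : ℝ) ^ m / ((m.factorial : ℝ) * ((m + n).factorial : ℝ)) * (x / 2) ^ (2 * m + n)

/-- For a determinantal point process with kernel `K`, the intensity function
`ρ_u(v) = |K(v,u)|² / K(u,u)` of the points pushed out by a point at `u`
(`K u u` is real for a Hermitian kernel). -/
noncomputable def pushedOutIntensity {E : Type*} (K : E → E → ℂ) (u v : E) : ℝ :=
  ‖K v u‖ ^ 2 / (K u u).re

/-- `f` is a probability density function with respect to the reference measure. -/
def IsProbabilityDensity {E : Type*} [MeasureSpace E] (f : E → ℝ) : Prop :=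
  Measurable f ∧ (∀ v, 0 ≤ f v) ∧ Integrable f ∧ ∫ v, f v = 1

/-- A kernel `K` is globally most repulsive if `p_u = ∫ |K(v,u)|² / K(u,u) dv` equals `1`
for all `u` with `K(u,u) > 0`. -/
def IsGloballyMostRepulsive {E : Type*} [MeasureSpace E] (K : E → E → ℂ) : Prop :=
  ∀ u, 0 < (K u u).re → ∫ v, pushedOutIntensity K u v = 1

/-- The stationary and isotropic kernel on `ℝᵈ` whose Fourier transform is the indicator of the
centred closed ball of volume `1/π`:
`K(v,w) = ∫_{|y|^d ≤ d Γ(d/2) / (2 π^(1+d/2))} exp(2πi (v-w)·y) dy`. -/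
noncomputable def ballKernel (d : ℕ) (v w : EuclideanSpace ℝ (Fin d)) : ℂ :=
  ∫ y in {y : EuclideanSpace ℝ (Fin d) |
      ‖y‖ ^ d ≤ (d : ℝ) * Real.Gamma ((d : ℝ) / 2) / (2 * Real.pi ^ (1 + (d : ℝ) / 2))},
    Complex.exp (2 * (Real.pi : ℂ) * Complex.I * ((inner ℝ (v - w) y : ℝ) : ℂ))

/-- The function `ρ_u(v) = π |K(u,v)|²` for the kernel `ballKernel d`. -/
noncomputable def ballDensity (d : ℕ) (u v : EuclideanSpace ℝ (Fin d)) : ℝ :=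
  Real.pi * ‖ballKernel d u v‖ ^ 2

/-! The kernel `ballKernel d v w` is the Fourier transform of the indicator of a ball of volume 1/π,
evaluated at w - v. Plancherel and translation invariance give ∫ |K(u,v)|² dv = 1/π, hence total
mass 1 and global repulsiveness.

For d = 2 the ball is the disc of radius 1/π. Its transform is radial; expanding the exponential and
integrating termwise over the disc produces the series of J₁.

The moments are computed without asymptotics of J₁. Let f be the indicator of the disc and 0 < k <
2. Up to a constant, |ξ₁|^k = ∫₀^∞ (1 - cos(2π s ξ₁)) s^(-1-k) ds, and by Plancherel ∫ 2(1 - cos(2π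
s ξ₁)) |𝓕 f(ξ)|² dξ is the squared L² distance between f and its horizontal translate by s. That
distance is found by slicing the disc into intervals, and its integral against s^(-1-k) is a
multiple of ∫ |re z|^(-k) over the disc (`lintegral_fourier_disc_abs_re_rpow`). Radiality replaces
|ξ₁|^k by |ξ|^k at the cost of an absolute cosine moment.

The resulting identity `lintegral_discProfile_mul_rpow_mul` lives in `ℝ≥0∞`. For k < 1 everything on
its right is finite, and Legendre duplication gives the closed form; at k = 1 the cosine moment of
order -1 diverges, so the first moment is infinite, and higher ones follow by comparison. For -2 < k
≤ 0 finiteness is elementary, and the formula is continued analytically: the k-th moment is the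
moment generating function of log |Z - u| at k. -/

/-! ### Plancherel for functions in L¹ ∩ L² -/

section Plancherel

variable {V : Type*} [NormedAddCommGroup V] [InnerProductSpace ℝ V] [FiniteDimensional ℝ V]
  [MeasurableSpace V] [BorelSpace V]

open scoped FourierTransform SchwartzMap

/-- The `L²` Fourier transform of an integrable square-integrable function is given by the
Fourier integral. -/
theorem fourier_toLp_ae_eq {f : V → ℂ} (hf : Integrable f) (hf2 : MemLp f 2) :
    (𝓕 (hf2.toLp f) : Lp (α := V) ℂ 2 volume) =ᵐ[volume] 𝓕 f := by
  have hcont : Continuous (𝓕 f) := VectorFourier.fourierIntegral_continuous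
    Real.continuous_fourierChar (by exact continuous_inner) hf
  have h1 : LocallyIntegrable (fun x => (𝓕 (hf2.toLp f) : Lp (α := V) ℂ 2 volume) x) volume :=
    (Lp.memLp (𝓕 (hf2.toLp f) : Lp (α := V) ℂ 2 volume)).locallyIntegrable (by norm_num)
  -- Both transforms are tested against smooth compactly supported g. In each pairing the transform
  -- moves onto g: by the definition for tempered distributions on one side, by Fubini on the other.
  refine ae_eq_of_integral_contDiff_smul_eq h1 hcont.locallyIntegrable fun g hg hgc => ?_
  have hg' : HasCompactSupport (fun x => (g x : ℂ)) := hgc.comp_left Complex.ofReal_zero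
  have hgd : ContDiff ℝ (⊤ : ℕ∞) (fun x => (g x : ℂ)) := Complex.ofRealCLM.contDiff.comp hg
  let G : 𝓢(V, ℂ) := hg'.toSchwartzMap hgd
  have hG : ∀ x, G x = (g x : ℂ) := fun x => rfl
  have key := congrArg (fun T => T G) (Lp.fourier_toTemperedDistribution_eq (hf2.toLp f))
  simp only [TemperedDistribution.fourier_apply, Lp.toTemperedDistribution_apply] at key
  have e1 : ∫ x, (𝓕 G) x • (hf2.toLp f) x = ∫ x, (𝓕 (G : V → ℂ)) x • f x := by
    refine integral_congr_ae ?_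
    filter_upwards [hf2.coeFn_toLp] with x hx
    rw [hx, SchwartzMap.fourier_coe]
  rw [e1] at key
  have e2 : ∫ x, (𝓕 (G : V → ℂ)) x • f x = ∫ x, G x • 𝓕 f x := by
    simpa using! VectorFourier.integral_fourierIntegral_smul_eq_flip (L := innerₗ V)
      Real.continuous_fourierChar continuous_inner G.integrable hf
  rw [e2] at key
  simpa [hG] using key.symm

/-- **Plancherel's theorem** for integrable square-integrable functions. -/
theorem lintegral_enorm_sq_fourier {f : V → ℂ} (hf : Integrable f) (hf2 : MemLp f 2) :
    ∫⁻ x, ‖𝓕 f x‖ₑ ^ 2 = ∫⁻ x, ‖f x‖ₑ ^ 2 := by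
  have h := Lp.norm_fourier_eq (hf2.toLp f)
  have h2 : eLpNorm (𝓕 f) 2 volume = eLpNorm f 2 volume := by
    rw [← eLpNorm_congr_ae (fourier_toLp_ae_eq hf hf2), ← Lp.enorm_def, ← ofReal_norm, h,
      ofReal_norm, Lp.enorm_def, eLpNorm_congr_ae hf2.coeFn_toLp]
  have h3 := congrArg (· ^ 2) h2
  have h4 : ∀ g : V → ℂ, eLpNorm g 2 volume ^ 2 = ∫⁻ x, ‖g x‖ₑ ^ 2 := fun g => by
    simpa using eLpNorm_nnreal_pow_eq_lintegral (p := 2) (f := g) (μ := volume) (by norm_num)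
  simpa only [h4] using h3

end Plancherel

/-! ### Fourier transforms of indicators -/

section Indicator

variable {V : Type*} [NormedAddCommGroup V] [InnerProductSpace ℝ V] [FiniteDimensional ℝ V]
  [MeasurableSpace V] [BorelSpace V]

open scoped FourierTransform

theorem fourier_indicator_one {s : Set V} (hs : MeasurableSet s) (w : V) :
    𝓕 (s.indicator fun _ => (1 : ℂ)) w =
      ∫ y in s, Complex.exp (2 * (Real.pi : ℂ) * Complex.I * ((inner ℝ (-w) y : ℝ) : ℂ)) := by
  rw [Real.fourier_eq', ← integral_indicator hs]
  refine integral_congr_ae (Filter.Eventually.of_forall fun y => ?_)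
  by_cases hy : y ∈ s
  · simp only [hy, Set.indicator_of_mem, smul_eq_mul, mul_one]
    congr 1
    rw [inner_neg_left, real_inner_comm]
    push_cast
    ring
  · simp [hy]

theorem lintegral_enorm_sq_fourier_indicator_one {s : Set V} (hs : MeasurableSet s)
    (hfin : volume s ≠ ⊤) :
    ∫⁻ x, ‖𝓕 (s.indicator fun _ => (1 : ℂ)) x‖ₑ ^ 2 = volume s := by
  rw [lintegral_enorm_sq_fourier ((integrable_indicator_iff hs).2 (integrableOn_const hfin))
    (memLp_indicator_const 2 hs 1 (Or.inr hfin)), ← lintegral_indicator_one hs]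
  refine lintegral_congr fun x => ?_
  by_cases hx : x ∈ s <;> simp [hx]

theorem continuous_fourier_indicator_one {s : Set V} (hs : MeasurableSet s)
    (hfin : volume s ≠ ⊤) : Continuous (𝓕 (s.indicator fun _ => (1 : ℂ))) :=
  VectorFourier.fourierIntegral_continuous Real.continuous_fourierChar (by exact continuous_inner)
    ((integrable_indicator_iff hs).2 (integrableOn_const hfin))

end Indicator

/-! ### The kernel and its density in every dimension -/

section GeneralDimension

open scoped FourierTransform

/-- The bound on ‖y‖ ^ d is r ^ d for a radius r; in the volume formula Γ(d/2 + 1) = (d/2) Γ(d/2)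
cancels everything except 1/π. -/
theorem exists_closedBall_volume_one_div_pi {d : ℕ} (hd : 1 ≤ d) :
    ∃ r : ℝ, 0 ≤ r ∧
      r ^ d = (d : ℝ) * Real.Gamma ((d : ℝ) / 2) / (2 * Real.pi ^ (1 + (d : ℝ) / 2)) ∧
      {y : EuclideanSpace ℝ (Fin d) |
        ‖y‖ ^ d ≤ (d : ℝ) * Real.Gamma ((d : ℝ) / 2) / (2 * Real.pi ^ (1 + (d : ℝ) / 2))} =
          Metric.closedBall 0 r ∧
      volume (Metric.closedBall (0 : EuclideanSpace ℝ (Fin d)) r) =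
        ENNReal.ofReal (1 / Real.pi) := by
  have hd0 : d ≠ 0 := by omega
  have hdr : (0 : ℝ) < d := by positivity
  have hG : 0 < Real.Gamma ((d : ℝ) / 2) := Real.Gamma_pos_of_pos (by positivity)
  set c := (d : ℝ) * Real.Gamma ((d : ℝ) / 2) / (2 * Real.pi ^ (1 + (d : ℝ) / 2)) with hc
  have hc0 : 0 ≤ c := by positivity
  have hr : (c ^ ((d : ℝ)⁻¹)) ^ d = c := Real.rpow_inv_natCast_pow hc0 hd0
  refine ⟨c ^ ((d : ℝ)⁻¹), by positivity, hr, ?_, ?_⟩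
  · ext y
    rw [Set.mem_ofPred_eq, mem_closedBall_zero_iff]
    conv_lhs => rw [← hr]
    exact pow_le_pow_iff_left₀ (norm_nonneg _) (by positivity) hd0
  · have : Nonempty (Fin d) := ⟨⟨0, hd⟩⟩
    rw [EuclideanSpace.volume_closedBall, ← ENNReal.ofReal_pow (by positivity), Fintype.card_fin,
      hr, ← ENNReal.ofReal_mul hc0, Real.Gamma_add_one (by positivity), hc]
    congr 1
    have h1 : Real.sqrt Real.pi ^ d = Real.pi ^ ((d : ℝ) / 2) := by
      rw [Real.sqrt_eq_rpow, ← Real.rpow_natCast, ← Real.rpow_mul Real.pi_pos.le]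
      ring_nf
    rw [h1, Real.rpow_add Real.pi_pos, Real.rpow_one]
    field_simp

theorem ballKernel_eq_fourier {d : ℕ} {r : ℝ}
    (hr : {y : EuclideanSpace ℝ (Fin d) |
        ‖y‖ ^ d ≤ (d : ℝ) * Real.Gamma ((d : ℝ) / 2) / (2 * Real.pi ^ (1 + (d : ℝ) / 2))} =
          Metric.closedBall 0 r) (v w : EuclideanSpace ℝ (Fin d)) :
    ballKernel d v w = 𝓕 ((Metric.closedBall (0 : EuclideanSpace ℝ (Fin d)) r).indicator
      fun _ => (1 : ℂ)) (w - v) := by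
  rw [fourier_indicator_one measurableSet_closedBall, ballKernel, hr, neg_sub]

theorem ballKernel_self {d : ℕ} (hd : 1 ≤ d) (u : EuclideanSpace ℝ (Fin d)) :
    ballKernel d u u = ((1 / Real.pi : ℝ) : ℂ) := by
  obtain ⟨r, -, -, hr, hvol⟩ := exists_closedBall_volume_one_div_pi hd
  rw [ballKernel, hr]
  simp [Measure.real, hvol, Real.pi_pos.le]

/-- The kernel is Hermitian: conjugating the integrand changes the sign of v - u. -/
theorem norm_ballKernel_comm {d : ℕ} (u v : EuclideanSpace ℝ (Fin d)) :
    ‖ballKernel d v u‖ = ‖ballKernel d u v‖ := by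
  rw [← Complex.norm_conj, ballKernel, ← integral_conj, ballKernel]
  congr 2
  ext y
  rw [← Complex.exp_conj]
  congr 1
  rw [← neg_sub u v, inner_neg_left]
  simp [map_ofNat]

theorem pushedOutIntensity_ballKernel {d : ℕ} (hd : 1 ≤ d) (u v : EuclideanSpace ℝ (Fin d)) :
    pushedOutIntensity (ballKernel d) u v = ballDensity d u v := by
  rw [pushedOutIntensity, ballKernel_self hd, ballDensity, norm_ballKernel_comm, Complex.ofReal_re]
  field_simp

theorem ofReal_ballDensity {d : ℕ} (u v : EuclideanSpace ℝ (Fin d)) :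
    ENNReal.ofReal (ballDensity d u v) = ENNReal.ofReal Real.pi * ‖ballKernel d u v‖ₑ ^ 2 := by
  rw [ballDensity, ENNReal.ofReal_mul Real.pi_pos.le, ENNReal.ofReal_pow (norm_nonneg _),
    ofReal_norm]

theorem continuous_ballKernel {d : ℕ} (hd : 1 ≤ d) (u : EuclideanSpace ℝ (Fin d)) :
    Continuous (ballKernel d u) := by
  obtain ⟨r, -, -, hr, hvol⟩ := exists_closedBall_volume_one_div_pi hd
  have h : ballKernel d u = fun v => _ := funext (ballKernel_eq_fourier hr u)
  rw [h]
  exact (continuous_fourier_indicator_one measurableSet_closedBall (by simp [hvol])).comp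
    (continuous_id.sub continuous_const)

theorem lintegral_ballDensity {d : ℕ} (hd : 1 ≤ d) (u : EuclideanSpace ℝ (Fin d)) :
    ∫⁻ v, ENNReal.ofReal (ballDensity d u v) = 1 := by
  obtain ⟨r, -, -, hr, hvol⟩ := exists_closedBall_volume_one_div_pi hd
  simp_rw [ofReal_ballDensity, ballKernel_eq_fourier hr]
  rw [lintegral_const_mul' _ _ ENNReal.ofReal_ne_top,
    lintegral_sub_right_eq_self (fun v => ‖𝓕 ((Metric.closedBall (0 : EuclideanSpace ℝ (Fin d))
      r).indicator fun _ => (1 : ℂ)) v‖ₑ ^ 2) u,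
    lintegral_enorm_sq_fourier_indicator_one measurableSet_closedBall (by simp [hvol]), hvol,
    ← ENNReal.ofReal_mul Real.pi_pos.le, mul_one_div_cancel Real.pi_ne_zero, ENNReal.ofReal_one]

theorem isProbabilityDensity_ballDensity {d : ℕ} (hd : 1 ≤ d) (u : EuclideanSpace ℝ (Fin d)) :
    IsProbabilityDensity (ballDensity d u) := by
  have hpos : ∀ v, 0 ≤ ballDensity d u v := fun v =>
    mul_nonneg Real.pi_pos.le (sq_nonneg _)
  have hm : Measurable (ballDensity d u) :=
    (((continuous_ballKernel hd u).norm.pow 2).const_mul Real.pi).measurable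
  refine ⟨hm, hpos, ?_, ?_⟩
  · rw [← lintegral_ofReal_ne_top_iff_integrable hm.aestronglyMeasurable
      (Filter.Eventually.of_forall hpos), lintegral_ballDensity hd]
    exact ENNReal.one_ne_top
  · rw [integral_eq_lintegral_of_nonneg_ae (Filter.Eventually.of_forall hpos)
      hm.aestronglyMeasurable, lintegral_ballDensity hd, ENNReal.toReal_one]

theorem isGloballyMostRepulsive_ballKernel {d : ℕ} (hd : 1 ≤ d) :
    IsGloballyMostRepulsive (ballKernel d) := by
  intro u _
  simp_rw [pushedOutIntensity_ballKernel hd]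
  exact (isProbabilityDensity_ballDensity hd u).2.2.2

end GeneralDimension

/-! ### Radial profile of the transform of the disc -/

section DiscProfile

open scoped FourierTransform

/-- The Fourier transform of the indicator of the disc of radius `1 / π`, as a function of the
distance to the origin. -/
noncomputable def discProfile (t : ℝ) : ℂ :=
  ∫ w in Metric.closedBall (0 : ℂ) Real.pi⁻¹,
    Complex.exp (2 * (Real.pi : ℂ) * Complex.I * ((t * w.re : ℝ) : ℂ))

theorem exists_linearIsometryEquiv_apply_norm {V : Type*} [NormedAddCommGroup V]
    [InnerProductSpace ℝ V] (e : ℂ ≃ₗᵢ[ℝ] V) (x : V) :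
    ∃ φ : ℂ ≃ₗᵢ[ℝ] V, φ ((‖x‖ : ℝ) : ℂ) = x := by
  refine ⟨(rotation (Circle.exp (e.symm x).arg)).trans e, ?_⟩
  rw [LinearIsometryEquiv.trans_apply, rotation_apply, Circle.coe_exp, mul_comm,
    ← e.symm.norm_map x, Complex.norm_mul_exp_arg_mul_I, e.apply_symm_apply]

/-- An isometry taking the positive real number ‖x‖ to x preserves the ball and turns the inner
product with x into ‖x‖ times the real part. With e left general, this serves both ℂ and
`EuclideanSpace ℝ (Fin 2)`. -/
theorem setIntegral_closedBall_exp_inner {V : Type*} [NormedAddCommGroup V]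
    [InnerProductSpace ℝ V] [FiniteDimensional ℝ V] [MeasurableSpace V] [BorelSpace V]
    (e : ℂ ≃ₗᵢ[ℝ] V) (x : V) :
    ∫ y in Metric.closedBall (0 : V) Real.pi⁻¹,
      Complex.exp (2 * (Real.pi : ℂ) * Complex.I * ((inner ℝ x y : ℝ) : ℂ)) = discProfile ‖x‖ := by
  obtain ⟨φ, hφ⟩ := exists_linearIsometryEquiv_apply_norm e x
  rw [← (φ.measurePreserving).setIntegral_preimage_emb φ.toHomeomorph.measurableEmbedding,
    discProfile]
  have hpre : φ ⁻¹' Metric.closedBall (0 : V) Real.pi⁻¹ = Metric.closedBall (0 : ℂ) Real.pi⁻¹ := by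
    ext w
    simp
  rw [hpre]
  congr 1
  ext w
  have : inner ℝ x (φ w) = ‖x‖ * w.re := by
    conv_lhs => rw [← hφ]
    rw [φ.inner_map_map, Complex.inner]
    simp [mul_comm]
  rw [this]

theorem fourier_disc_eq_discProfile (z : ℂ) :
    𝓕 ((Metric.closedBall (0 : ℂ) Real.pi⁻¹).indicator fun _ => (1 : ℂ)) z = discProfile ‖z‖ := by
  rw [fourier_indicator_one measurableSet_closedBall,
    setIntegral_closedBall_exp_inner (LinearIsometryEquiv.refl ℝ ℂ), norm_neg]

theorem ballKernel_two_eq_discProfile (u v : EuclideanSpace ℝ (Fin 2)) :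
    ballKernel 2 u v = discProfile ‖v - u‖ := by
  obtain ⟨r, hr0, hrd, hr, -⟩ := exists_closedBall_volume_one_div_pi (d := 2) (by norm_num)
  -- For d = 2 the bound is 2 Γ(1) / (2π²) = π⁻².
  have hrpi : r = Real.pi⁻¹ := by
    refine (pow_left_inj₀ hr0 (by positivity) two_ne_zero).1 ?_
    rw [hrd]
    norm_num
    field_simp
  rw [ballKernel, hr, hrpi, setIntegral_closedBall_exp_inner Complex.orthonormalBasisOneI.repr,
    norm_sub_rev]

end DiscProfile

/-! ### Power series of the profile and J₁ -/

section Bessel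

open Real in
theorem integral_cos_pow_neg_pi_pi_succ_succ (n : ℕ) :
    ∫ θ in (-π)..π, cos θ ^ (n + 2) = (n + 1) / (n + 2) * ∫ θ in (-π)..π, cos θ ^ n := by
  rw [integral_cos_pow]
  simp

open Real in
theorem integral_cos_pow_neg_pi_pi_odd (m : ℕ) :
    ∫ θ in (-π)..π, cos θ ^ (2 * m + 1) = 0 := by
  induction m with
  | zero => simp
  | succ m ih =>
    rw [show 2 * (m + 1) + 1 = (2 * m + 1) + 2 by ring, integral_cos_pow_neg_pi_pi_succ_succ, ih,
      mul_zero]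

open Real in
theorem integral_cos_pow_neg_pi_pi_even (m : ℕ) :
    ∫ θ in (-π)..π, cos θ ^ (2 * m) =
      2 * π * (2 * m).factorial / (4 ^ m * (m.factorial : ℝ) ^ 2) := by
  induction m with
  | zero => simp; ring
  | succ m ih =>
    rw [show 2 * (m + 1) = 2 * m + 2 by ring, integral_cos_pow_neg_pi_pi_succ_succ, ih,
      Nat.factorial_succ, Nat.factorial_succ, Nat.factorial_succ]
    push_cast
    field_simp
    ring

/-- The moments of the first coordinate on a disc. -/
theorem setIntegral_closedBall_re_pow {R : ℝ} (hR : 0 ≤ R) (n : ℕ) :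
    ∫ w in Metric.closedBall (0 : ℂ) R, w.re ^ n =
      R ^ (n + 2) / (n + 2) * ∫ θ in (-Real.pi)..Real.pi, Real.cos θ ^ n := by
  rw [← integral_indicator measurableSet_closedBall, ← Complex.integral_comp_polarCoord_symm]
  have h : ∀ p ∈ polarCoord.target, p.1 • (Metric.closedBall (0 : ℂ) R).indicator
      (fun w : ℂ => w.re ^ n) (Complex.polarCoord.symm p) =
      (Set.Iic R).indicator (fun r => r ^ (n + 1)) p.1 * Real.cos p.2 ^ n := by
    rintro ⟨r, θ⟩ ⟨hr, -⟩
    have hr' : 0 < r := hr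
    have hre : (Complex.polarCoord.symm (r, θ)).re = r * Real.cos θ := by
      simp [-Complex.ofReal_cos]
    have hmem : Complex.polarCoord.symm (r, θ) ∈ Metric.closedBall (0 : ℂ) R ↔ r ∈ Set.Iic R := by
      rw [mem_closedBall_zero_iff, Complex.norm_polarCoord_symm, abs_of_pos hr', Set.mem_Iic]
    by_cases hrR : r ∈ Set.Iic R
    · rw [Set.indicator_of_mem (hmem.2 hrR), Set.indicator_of_mem hrR, hre]
      simp only [smul_eq_mul]
      ring
    · rw [Set.indicator_of_notMem (mt hmem.1 hrR), Set.indicator_of_notMem hrR]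
      simp
  rw [setIntegral_congr_fun polarCoord.open_target.measurableSet h, polarCoord_target,
    Measure.volume_eq_prod, setIntegral_prod_mul (μ := volume) (ν := volume)
      ((Set.Iic R).indicator (fun r : ℝ => r ^ (n + 1))) (fun θ => Real.cos θ ^ n), setIntegral_indicator measurableSet_Iic,
    Set.Ioi_inter_Iic, ← intervalIntegral.integral_of_le hR, integral_pow,
    ← integral_Ioc_eq_integral_Ioo, ← intervalIntegral.integral_of_le (by linarith [Real.pi_pos])]
  congr 2
  · simp
  · push_cast
    ring

theorem hasSum_discProfile (t : ℝ) :
    HasSum (fun n : ℕ => ((2 * (Real.pi : ℂ) * Complex.I * t) ^ n / n.factorial) *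
      ((∫ w in Metric.closedBall (0 : ℂ) Real.pi⁻¹, w.re ^ n : ℝ) : ℂ)) (discProfile t) := by
  have hfin : volume (Metric.closedBall (0 : ℂ) Real.pi⁻¹) ≠ ⊤ := measure_closedBall_lt_top.ne
  have h := hasSum_integral_of_dominated_convergence
    (μ := volume.restrict (Metric.closedBall (0 : ℂ) Real.pi⁻¹))
    (F := fun (n : ℕ) (w : ℂ) => (2 * (Real.pi : ℂ) * Complex.I * ((t * w.re : ℝ) : ℂ)) ^ n /
      (n.factorial : ℂ))
    (f := fun w => Complex.exp (2 * (Real.pi : ℂ) * Complex.I * ((t * w.re : ℝ) : ℂ)))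
    -- On the disc |re w| ≤ 1/π, which cancels the π in 2π|t||re w|.
    (bound := fun n _ => (2 * |t|) ^ n / n.factorial) ?_ ?_ ?_ ?_ ?_
  · refine h.congr_fun fun n => ?_
    rw [← integral_complex_ofReal, ← integral_const_mul]
    congr 1
    ext w
    push_cast
    ring
  · intro n
    exact Continuous.aestronglyMeasurable (by fun_prop)
  · intro n
    filter_upwards [ae_restrict_mem measurableSet_closedBall] with w hw
    have h1 : |w.re| ≤ Real.pi⁻¹ := (Complex.abs_re_le_norm w).trans (mem_closedBall_zero_iff.1 hw)
    rw [norm_div, norm_pow, Complex.norm_natCast]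
    gcongr
    simp only [norm_mul, Complex.norm_ofNat, Complex.norm_real, Complex.norm_I, mul_one,
      Real.norm_eq_abs, abs_of_pos Real.pi_pos]
    calc 2 * Real.pi * (|t| * |w.re|) ≤ 2 * Real.pi * (|t| * Real.pi⁻¹) := by gcongr
      _ = 2 * |t| := by field_simp
  · exact Filter.Eventually.of_forall fun _ => Real.summable_pow_div_factorial _
  · exact integrableOn_const hfin
  · refine Filter.Eventually.of_forall fun w => ?_
    rw [Complex.exp_eq_exp_ℂ]
    exact NormedSpace.expSeries_div_hasSum_exp _

/-- Odd moments of the real part vanish. In the even terms the factor (2m)! of the cosine moment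
cancels that of the exponential series, leaving the series of J₁(2t) with one power of t divided
out, whence t ≠ 0. -/
theorem discProfile_eq_besselJ {t : ℝ} (ht : t ≠ 0) :
    discProfile t = ((besselJ 1 (2 * t) / (Real.pi * t) : ℝ) : ℂ) := by
  have h := hasSum_discProfile t
  have hodd : ∀ n : ℕ, n ∉ Set.range (fun m : ℕ => 2 * m) →
      ((2 * (Real.pi : ℂ) * Complex.I * t) ^ n / n.factorial) *
      ((∫ w in Metric.closedBall (0 : ℂ) Real.pi⁻¹, w.re ^ n : ℝ) : ℂ) = 0 := by
    intro n hn
    have : Odd n := by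
      rw [← Nat.not_even_iff_odd]
      rintro ⟨m, rfl⟩
      exact hn ⟨m, by simp; ring⟩
    obtain ⟨m, rfl⟩ := this
    rw [setIntegral_closedBall_re_pow (by positivity), integral_cos_pow_neg_pi_pi_odd]
    simp
  have h2 := (Function.Injective.hasSum_iff
    (f := fun n : ℕ => ((2 * (Real.pi : ℂ) * Complex.I * t) ^ n / n.factorial) *
      ((∫ w in Metric.closedBall (0 : ℂ) Real.pi⁻¹, w.re ^ n : ℝ) : ℂ))
    (mul_right_injective₀ (two_ne_zero : (2 : ℕ) ≠ 0)) hodd).2 h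
  have h3 : ∀ m : ℕ, ((2 * (Real.pi : ℂ) * Complex.I * t) ^ (2 * m) / (2 * m).factorial) *
      ((∫ w in Metric.closedBall (0 : ℂ) Real.pi⁻¹, w.re ^ (2 * m) : ℝ) : ℂ) =
      (((-1 : ℝ) ^ m / ((m.factorial : ℝ) * ((m + 1).factorial : ℝ)) *
        (2 * t / 2) ^ (2 * m + 1) / (Real.pi * t) : ℝ) : ℂ) := by
    intro m
    rw [setIntegral_closedBall_re_pow (by positivity), integral_cos_pow_neg_pi_pi_even,
      Nat.factorial_succ m]
    have e1 : (2 * (Real.pi : ℂ) * Complex.I * t) ^ (2 * m) =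
        (((-1) ^ m * 4 ^ m * Real.pi ^ (2 * m) * t ^ (2 * m) : ℝ) : ℂ) := by
      rw [mul_pow, mul_pow, mul_pow, pow_mul Complex.I, Complex.I_sq, pow_mul (2 : ℂ)]
      push_cast
      rw [show (2 : ℂ) ^ 2 = 4 by norm_num]
      ring
    rw [e1]
    have e2 : (((2 * m).factorial : ℕ) : ℂ) = (((2 * m).factorial : ℝ) : ℂ) := by simp
    rw [e2, ← Complex.ofReal_div, ← Complex.ofReal_mul]
    congr 1
    have : (m.factorial : ℝ) ≠ 0 := by positivity
    have : ((2 * m).factorial : ℝ) ≠ 0 := by positivity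
    push_cast
    rw [mul_div_cancel_left₀ t two_ne_zero, inv_pow]
    field_simp
    ring
  have h4 : HasSum (fun m : ℕ => (((-1 : ℝ) ^ m / ((m.factorial : ℝ) * ((m + 1).factorial : ℝ)) *
        (2 * t / 2) ^ (2 * m + 1) / (Real.pi * t) : ℝ) : ℂ)) (discProfile t) :=
    h2.congr_fun fun m => (h3 m).symm
  rw [← h4.tsum_eq, ← Complex.ofReal_tsum, tsum_div_const, besselJ]

theorem ballDensity_two_of_ne {u v : EuclideanSpace ℝ (Fin 2)} (h : v ≠ u) :
    ballDensity 2 u v = besselJ 1 (2 * ‖v - u‖) ^ 2 / (Real.pi * ‖v - u‖ ^ 2) := by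
  have hn : ‖v - u‖ ≠ 0 := norm_ne_zero_iff.2 (sub_ne_zero.2 h)
  rw [ballDensity, ballKernel_two_eq_discProfile, discProfile_eq_besselJ hn, Complex.norm_real,
    Real.norm_eq_abs, sq_abs]
  field_simp

theorem ballDensity_self {d : ℕ} (hd : 1 ≤ d) (u : EuclideanSpace ℝ (Fin d)) :
    ballDensity d u u = 1 / Real.pi := by
  rw [ballDensity, ballKernel_self hd, Complex.norm_real, Real.norm_eq_abs, sq_abs]
  field_simp

end Bessel

/-! ### Gamma integrals and the integral of (1 - cos s) s^(-1-k) -/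

section GammaIntegrals

open Set

theorem lintegral_rpow_mul_exp_neg_mul_rpow {p q b : ℝ} (hp : 0 < p) (hq : -1 < q) (hb : 0 < b) :
    ∫⁻ x in Ioi (0 : ℝ), ENNReal.ofReal (x ^ q * Real.exp (-b * x ^ p)) =
      ENNReal.ofReal (b ^ (-(q + 1) / p) * (1 / p) * Real.Gamma ((q + 1) / p)) := by
  rw [← integral_rpow_mul_exp_neg_mul_rpow hp hq hb, ofReal_integral_eq_lintegral_ofReal
    (integrableOn_rpow_mul_exp_neg_mul_rpow hq hp hb)]
  filter_upwards [ae_restrict_mem measurableSet_Ioi] with x hx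
  exact mul_nonneg (Real.rpow_nonneg (le_of_lt hx) _) (Real.exp_pos _).le

theorem lintegral_rpow_mul_exp_neg_mul {q b : ℝ} (hq : -1 < q) (hb : 0 < b) :
    ∫⁻ x in Ioi (0 : ℝ), ENNReal.ofReal (x ^ q * Real.exp (-b * x)) =
      ENNReal.ofReal (b ^ (-(q + 1)) * Real.Gamma (q + 1)) := by
  simpa using lintegral_rpow_mul_exp_neg_mul_rpow one_pos hq hb

/-- The integrand is the real part of exp(-bs) - exp((-b + i)s), so the value is 1/b - b/(1 + b²).
-/
theorem lintegral_one_sub_cos_mul_exp_neg {b : ℝ} (hb : 0 < b) :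
    ∫⁻ s in Ioi (0 : ℝ), ENNReal.ofReal ((1 - Real.cos s) * Real.exp (-b * s)) =
      ENNReal.ofReal (1 / (b * (1 + b ^ 2))) := by
  have h1 : ((-b : ℝ) : ℂ).re < 0 := by simpa using hb
  have h2 : (((-b : ℝ) : ℂ) + Complex.I).re < 0 := by simpa using hb
  have hI := (integrableOn_exp_mul_complex_Ioi h1 0).sub (integrableOn_exp_mul_complex_Ioi h2 0)
  have hre : ∀ s : ℝ, (Complex.exp (((-b : ℝ) : ℂ) * s) -
      Complex.exp ((((-b : ℝ) : ℂ) + Complex.I) * s)).re =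
      (1 - Real.cos s) * Real.exp (-b * s) := by
    intro s
    rw [Complex.sub_re, Complex.exp_re, Complex.exp_re]
    simp
    ring
  have hv : ∫ s in Ioi (0 : ℝ), (1 - Real.cos s) * Real.exp (-b * s) = 1 / (b * (1 + b ^ 2)) := by
    calc ∫ s in Ioi (0 : ℝ), (1 - Real.cos s) * Real.exp (-b * s)
        = (∫ s in Ioi (0 : ℝ), (Complex.exp (((-b : ℝ) : ℂ) * s) -
            Complex.exp ((((-b : ℝ) : ℂ) + Complex.I) * s))).re := by
          simp_rw [← hre]
          exact integral_re hI
      _ = _ := by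
          rw [integral_sub (integrableOn_exp_mul_complex_Ioi h1 0)
            (integrableOn_exp_mul_complex_Ioi h2 0), integral_exp_mul_complex_Ioi h1,
            integral_exp_mul_complex_Ioi h2]
          simp [Complex.div_re, Complex.normSq_apply]
          field_simp
          ring
  rw [← hv, ofReal_integral_eq_lintegral_ofReal]
  · have := hI.re
    exact this.congr (Filter.Eventually.of_forall hre)
  · exact Filter.Eventually.of_forall fun s =>
      mul_nonneg (sub_nonneg.2 (Real.cos_le_one s)) (Real.exp_pos _).le

/-- Write 1/(1 + x²) as ∫₀^∞ exp(-(1 + x²)t) dt and apply Tonelli; both remaining integrals are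
Gamma integrals. -/
theorem lintegral_rpow_div_one_add_sq {k : ℝ} (hk0 : 0 < k) (hk2 : k < 2) :
    ∫⁻ x in Ioi (0 : ℝ), ENNReal.ofReal (x ^ (k - 1) * (1 / (1 + x ^ 2))) =
      ENNReal.ofReal (Real.Gamma (k / 2) * Real.Gamma (1 - k / 2) / 2) := by
  have h1 : ∀ x ∈ Ioi (0 : ℝ), ENNReal.ofReal (x ^ (k - 1) * (1 / (1 + x ^ 2))) =
      ∫⁻ t in Ioi (0 : ℝ), ENNReal.ofReal (x ^ (k - 1) * Real.exp (-(1 + x ^ 2) * t)) := by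
    intro x hx
    have hx0 : 0 ≤ x ^ (k - 1) := Real.rpow_nonneg (le_of_lt hx) _
    have := lintegral_rpow_mul_exp_neg_mul (q := 0) (b := 1 + x ^ 2) (by norm_num) (by positivity)
    simp only [Real.rpow_zero, one_mul, zero_add, Real.Gamma_one, mul_one, Real.rpow_neg_one]
      at this
    simp_rw [ENNReal.ofReal_mul hx0]
    rw [lintegral_const_mul' _ _ ENNReal.ofReal_ne_top, this, one_div]
  rw [setLIntegral_congr_fun measurableSet_Ioi h1, lintegral_lintegral_swap]
  · have h2 : ∀ t ∈ Ioi (0 : ℝ),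
        ∫⁻ x in Ioi (0 : ℝ), ENNReal.ofReal (x ^ (k - 1) * Real.exp (-(1 + x ^ 2) * t)) =
        ENNReal.ofReal (Real.Gamma (k / 2) / 2) *
          ENNReal.ofReal (t ^ (-(k / 2)) * Real.exp (-1 * t)) := by
      intro t ht
      have := lintegral_rpow_mul_exp_neg_mul_rpow (p := 2) (q := k - 1) two_pos (by linarith) ht
      rw [← ENNReal.ofReal_mul (by have := Real.Gamma_pos_of_pos (half_pos hk0); positivity)]
      calc _ = ∫⁻ x in Ioi (0 : ℝ), ENNReal.ofReal (Real.exp (-t)) *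
            ENNReal.ofReal (x ^ (k - 1) * Real.exp (-t * x ^ (2 : ℝ))) := by
            refine lintegral_congr fun x => ?_
            rw [← ENNReal.ofReal_mul (Real.exp_pos _).le, mul_left_comm, ← Real.exp_add]
            congr 3
            rw [Real.rpow_two]
            ring
        _ = _ := by
            rw [lintegral_const_mul' _ _ ENNReal.ofReal_ne_top, this,
              ← ENNReal.ofReal_mul (Real.exp_pos _).le]
            congr 1
            rw [show -(k - 1 + 1) / 2 = -(k / 2) by ring, show (k - 1 + 1) / 2 = k / 2 by ring,
              neg_one_mul]
            ring
    rw [setLIntegral_congr_fun measurableSet_Ioi h2,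
      lintegral_const_mul' _ _ ENNReal.ofReal_ne_top,
      lintegral_rpow_mul_exp_neg_mul (by linarith) one_pos, ← ENNReal.ofReal_mul
        (by have := Real.Gamma_pos_of_pos (half_pos hk0); positivity)]
    congr 1
    rw [Real.one_rpow, show -(k / 2) + 1 = 1 - k / 2 by ring]
    ring
  · exact Measurable.aemeasurable (by fun_prop)

/-- Write Γ(1 + k) s^(-1-k) as the Laplace transform of x^k at s. After Tonelli the s-integral
equals 1/(x(1 + x²)), which reduces to `lintegral_rpow_div_one_add_sq`. -/
theorem lintegral_one_sub_cos_mul_rpow {k : ℝ} (hk0 : 0 < k) (hk2 : k < 2) :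
    ∫⁻ s in Ioi (0 : ℝ), ENNReal.ofReal ((1 - Real.cos s) * s ^ (-1 - k)) =
      ENNReal.ofReal (Real.Gamma (k / 2) * Real.Gamma (1 - k / 2) / (2 * Real.Gamma (1 + k))) := by
  have hG : 0 < Real.Gamma (1 + k) := Real.Gamma_pos_of_pos (by linarith)
  have hc : ∀ s : ℝ, 0 ≤ 1 - Real.cos s := fun s => sub_nonneg.2 (Real.cos_le_one s)
  have h1 : ∀ s ∈ Ioi (0 : ℝ), ENNReal.ofReal ((1 - Real.cos s) * s ^ (-1 - k)) =
      ENNReal.ofReal (Real.Gamma (1 + k))⁻¹ * ∫⁻ x in Ioi (0 : ℝ),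
        ENNReal.ofReal ((1 - Real.cos s) * (x ^ k * Real.exp (-s * x))) := by
    intro s hs
    simp_rw [ENNReal.ofReal_mul (hc s)]
    rw [lintegral_const_mul' _ _ ENNReal.ofReal_ne_top,
      lintegral_rpow_mul_exp_neg_mul (by linarith) hs, ← ENNReal.ofReal_mul (hc s),
      ← ENNReal.ofReal_mul (hc s), ← ENNReal.ofReal_mul (by positivity)]
    congr 1
    rw [add_comm k 1, show -(1 + k) = -1 - k by ring]
    field_simp
  rw [setLIntegral_congr_fun measurableSet_Ioi h1, lintegral_const_mul' _ _ ENNReal.ofReal_ne_top,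
    lintegral_lintegral_swap]
  · have h2 : ∀ x ∈ Ioi (0 : ℝ), ∫⁻ s in Ioi (0 : ℝ),
        ENNReal.ofReal ((1 - Real.cos s) * (x ^ k * Real.exp (-s * x))) =
        ENNReal.ofReal (x ^ (k - 1) * (1 / (1 + x ^ 2))) := by
      intro x hx
      have hx' : 0 < x := hx
      have hxk : 0 ≤ x ^ k := Real.rpow_nonneg hx'.le _
      calc _ = ∫⁻ s in Ioi (0 : ℝ), ENNReal.ofReal (x ^ k) *
            ENNReal.ofReal ((1 - Real.cos s) * Real.exp (-x * s)) := by
            refine lintegral_congr fun s => ?_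
            rw [← ENNReal.ofReal_mul hxk]
            congr 1
            rw [show -s * x = -x * s by ring]
            ring
        _ = _ := by
            rw [lintegral_const_mul' _ _ ENNReal.ofReal_ne_top,
              lintegral_one_sub_cos_mul_exp_neg hx', ← ENNReal.ofReal_mul hxk,
              Real.rpow_sub_one hx'.ne']
            congr 1
            field_simp
    rw [setLIntegral_congr_fun measurableSet_Ioi h2, lintegral_rpow_div_one_add_sq hk0 hk2,
      ← ENNReal.ofReal_mul (by positivity)]
    congr 1
    field_simp
  · exact Measurable.aemeasurable (by fun_prop)

/-- The scaled version of `lintegral_one_sub_cos_mul_rpow`. -/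
theorem lintegral_one_sub_cos_const_mul_rpow {k : ℝ} (hk0 : 0 < k) (hk2 : k < 2) (c : ℝ) :
    ∫⁻ s in Ioi (0 : ℝ), ENNReal.ofReal ((1 - Real.cos (c * s)) * s ^ (-1 - k)) =
      ENNReal.ofReal (|c| ^ k) * ENNReal.ofReal
        (Real.Gamma (k / 2) * Real.Gamma (1 - k / 2) / (2 * Real.Gamma (1 + k))) := by
  rcases eq_or_ne c 0 with rfl | hc
  · simp [Real.zero_rpow hk0.ne']
  have hc' : 0 < |c| := abs_pos.2 hc
  rw [← lintegral_one_sub_cos_mul_rpow hk0 hk2]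
  have himg : (fun s => |c| * s) '' Ioi (0 : ℝ) = Ioi 0 := by
    simp [image_mul_left_Ioi hc']
  conv_rhs => rw [← himg]
  rw [lintegral_image_eq_lintegral_abs_deriv_mul measurableSet_Ioi
    (f := fun s => |c| * s) (f' := fun _ => |c|)
    (fun x _ => by simpa using ((hasDerivAt_id x).const_mul |c|).hasDerivWithinAt)
    (mul_right_injective₀ hc'.ne').injOn,
    ← lintegral_const_mul' _ _ ENNReal.ofReal_ne_top]
  refine setLIntegral_congr_fun measurableSet_Ioi fun s hs => ?_
  have hs' : 0 < s := hs
  simp only [abs_abs]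
  rw [← ENNReal.ofReal_mul (abs_nonneg c), ← ENNReal.ofReal_mul (by positivity),
    Real.mul_rpow (abs_nonneg c) hs'.le, Real.rpow_sub hc', Real.rpow_neg_one]
  have : Real.cos (|c| * s) = Real.cos (c * s) := by
    rw [← Real.cos_abs (c * s), abs_mul, abs_of_pos hs']
  rw [this]
  congr 1
  have : 0 < |c| ^ k := by positivity
  field_simp

end GammaIntegrals

/-! ### Polar coordinates and absolute cosine moments -/

section PolarMoments

open Set
open scoped ENNReal

/-- The absolute moments of the cosine over a full period. -/
noncomputable def absCosMoment (a : ℝ) : ℝ≥0∞ :=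
  ∫⁻ θ in Ioo (-Real.pi) Real.pi, ENNReal.ofReal (|Real.cos θ| ^ a)

theorem lintegral_radial_mul_abs_re_rpow {F : ℝ → ℝ≥0∞} (hF : Measurable F) (a : ℝ) :
    ∫⁻ z : ℂ, F ‖z‖ * ENNReal.ofReal (|z.re| ^ a) =
      (∫⁻ r in Ioi (0 : ℝ), ENNReal.ofReal (r ^ (1 + a)) * F r) * absCosMoment a := by
  rw [← Complex.lintegral_comp_polarCoord_symm]
  have h : ∀ p ∈ polarCoord.target, ENNReal.ofReal p.1 • (F ‖Complex.polarCoord.symm p‖ *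
      ENNReal.ofReal (|(Complex.polarCoord.symm p).re| ^ a)) =
      (ENNReal.ofReal (p.1 ^ (1 + a)) * F p.1) * ENNReal.ofReal (|Real.cos p.2| ^ a) := by
    rintro ⟨r, θ⟩ ⟨hr, -⟩
    have hr' : 0 < r := hr
    have hre : (Complex.polarCoord.symm (r, θ)).re = r * Real.cos θ := by
      simp [-Complex.ofReal_cos]
    rw [Complex.norm_polarCoord_symm, abs_of_pos hr', hre, abs_mul, abs_of_pos hr',
      Real.mul_rpow hr'.le (abs_nonneg _), ENNReal.ofReal_mul (by positivity),
      Real.rpow_add hr', Real.rpow_one, ENNReal.ofReal_mul hr'.le, smul_eq_mul]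
    ring
  rw [setLIntegral_congr_fun polarCoord.open_target.measurableSet h, polarCoord_target,
    Measure.volume_eq_prod, ← Measure.prod_restrict,
    lintegral_prod_mul (f := fun r => ENNReal.ofReal (r ^ (1 + a)) * F r)
      (g := fun θ => ENNReal.ofReal (|Real.cos θ| ^ a)), absCosMoment]
  · exact Measurable.aemeasurable (by fun_prop)
  · exact Measurable.aemeasurable (by fun_prop)

theorem absCosMoment_zero : absCosMoment 0 = ENNReal.ofReal (2 * Real.pi) := by
  simp [absCosMoment, two_mul]

theorem lintegral_radial {F : ℝ → ℝ≥0∞} (hF : Measurable F) :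
    ∫⁻ z : ℂ, F ‖z‖ =
      (∫⁻ r in Ioi (0 : ℝ), ENNReal.ofReal r * F r) * ENNReal.ofReal (2 * Real.pi) := by
  have h := lintegral_radial_mul_abs_re_rpow hF 0
  simpa [absCosMoment_zero] using h

/-- For a radial weight, |re z|^a and ‖z‖^a differ only by the angular mean of |cos|^a. The product
form avoids division, so infinite values are allowed. -/
theorem lintegral_radial_mul_abs_re_rpow_eq {F : ℝ → ℝ≥0∞} (hF : Measurable F) (a : ℝ) :
    ENNReal.ofReal (2 * Real.pi) * ∫⁻ z : ℂ, F ‖z‖ * ENNReal.ofReal (|z.re| ^ a) =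
      absCosMoment a * ∫⁻ z : ℂ, F ‖z‖ * ENNReal.ofReal (‖z‖ ^ a) := by
  rw [lintegral_radial_mul_abs_re_rpow hF,
    lintegral_radial (F := fun r => F r * ENNReal.ofReal (r ^ a)) (by fun_prop)]
  have h : ∀ r ∈ Ioi (0 : ℝ), ENNReal.ofReal r * (F r * ENNReal.ofReal (r ^ a)) =
      ENNReal.ofReal (r ^ (1 + a)) * F r := by
    intro r hr
    have hr' : 0 < r := hr
    rw [Real.rpow_add hr', Real.rpow_one, ENNReal.ofReal_mul hr'.le]
    ring
  rw [setLIntegral_congr_fun measurableSet_Ioi h]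
  ring

theorem lintegral_comp_abs (f : ℝ → ℝ≥0∞) :
    ∫⁻ x : ℝ, f |x| = 2 * ∫⁻ x in Ioi (0 : ℝ), f x := by
  have h1 : ∫⁻ x in Ioi (0 : ℝ), f |x| = ∫⁻ x in Ioi (0 : ℝ), f x :=
    setLIntegral_congr_fun measurableSet_Ioi fun x hx => by rw [abs_of_pos hx]
  have h2 : ∫⁻ x in Iic (0 : ℝ), f |x| = ∫⁻ x in Ioi (0 : ℝ), f x := by
    rw [setLIntegral_congr Iio_ae_eq_Iic.symm, ← h1,
      ← (Measure.measurePreserving_neg (volume : Measure ℝ)).setLIntegral_comp_preimage_emb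
        (MeasurableEquiv.neg ℝ).measurableEmbedding]
    simp
  rw [← lintegral_add_compl _ (measurableSet_Ioi (a := (0 : ℝ))), compl_Ioi, h1, h2, two_mul]

theorem lintegral_complex_eq {f : ℂ → ℝ≥0∞} (hf : Measurable f) :
    ∫⁻ z, f z = ∫⁻ y : ℝ, ∫⁻ x : ℝ, f ⟨x, y⟩ := by
  rw [← Complex.volume_preserving_equiv_real_prod.symm.lintegral_comp hf, Measure.volume_eq_prod,
    lintegral_prod_symm' (fun p => f (Complex.measurableEquivRealProd.symm p))
      (hf.comp Complex.measurableEquivRealProd.symm.measurable)]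
  rfl

/-- The integral of |re z|^a exp(-‖z‖²) is computed in polar and in Cartesian coordinates. The range
-2 < a includes a = -1, where the one-dimensional factor diverges. -/
theorem absCosMoment_mul {a : ℝ} (ha : -2 < a) :
    ENNReal.ofReal (Real.Gamma (a / 2 + 1) / 2) * absCosMoment a =
      2 * (∫⁻ x in Ioi (0 : ℝ), ENNReal.ofReal (x ^ a * Real.exp (-1 * x ^ (2 : ℝ)))) *
        ENNReal.ofReal (Real.sqrt Real.pi) := by
  have hF : Measurable fun r : ℝ => ENNReal.ofReal (Real.exp (-r ^ 2)) := by fun_prop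
  have h1 := lintegral_radial_mul_abs_re_rpow hF a
  have h2 : ∫⁻ r in Ioi (0 : ℝ), ENNReal.ofReal (r ^ (1 + a)) * ENNReal.ofReal (Real.exp (-r ^ 2)) =
      ENNReal.ofReal (Real.Gamma (a / 2 + 1) / 2) := by
    have := lintegral_rpow_mul_exp_neg_mul_rpow (p := 2) (q := 1 + a) (b := 1) two_pos
      (by linarith) one_pos
    rw [Real.one_rpow, show (1 + a + 1) / 2 = a / 2 + 1 by ring] at this
    rw [show Real.Gamma (a / 2 + 1) / 2 = 1 * (1 / 2) * Real.Gamma (a / 2 + 1) by ring, ← this]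
    refine setLIntegral_congr_fun measurableSet_Ioi fun r hr => ?_
    have hr' : 0 < r := hr
    rw [← ENNReal.ofReal_mul (by positivity), Real.rpow_two, neg_one_mul]
  rw [h2] at h1
  rw [← h1, lintegral_complex_eq (by fun_prop)]
  have h3 : ∀ x y : ℝ, ENNReal.ofReal (Real.exp (-‖(⟨x, y⟩ : ℂ)‖ ^ 2)) *
      ENNReal.ofReal (|(⟨x, y⟩ : ℂ).re| ^ a) =
      ENNReal.ofReal (Real.exp (-1 * y ^ 2)) *
        ENNReal.ofReal (|x| ^ a * Real.exp (-1 * |x| ^ (2 : ℝ))) := by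
    intro x y
    rw [← ENNReal.ofReal_mul (by positivity), ← ENNReal.ofReal_mul (by positivity), Complex.sq_norm,
      Complex.normSq_mk, mul_left_comm, ← Real.exp_add, Real.rpow_two, sq_abs, mul_comm]
    congr 3
    ring
  simp_rw [h3]
  have h4 : ∫⁻ y : ℝ, ENNReal.ofReal (Real.exp (-1 * y ^ 2)) =
      ENNReal.ofReal (Real.sqrt Real.pi) := by
    rw [← ofReal_integral_eq_lintegral_ofReal (integrable_exp_neg_mul_sq one_pos)
      (Filter.Eventually.of_forall fun _ => (Real.exp_pos _).le), integral_gaussian, div_one]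
  simp_rw [lintegral_const_mul' _ _ ENNReal.ofReal_ne_top]
  rw [lintegral_mul_const _ (by fun_prop), h4,
    lintegral_comp_abs fun x => ENNReal.ofReal (x ^ a * Real.exp (-1 * x ^ (2 : ℝ))), mul_comm]

theorem absCosMoment_eq {a : ℝ} (ha : -1 < a) :
    absCosMoment a = ENNReal.ofReal
      (2 * Real.sqrt Real.pi * Real.Gamma ((a + 1) / 2) / Real.Gamma (a / 2 + 1)) := by
  have h := absCosMoment_mul (a := a) (by linarith)
  have hG : 0 < Real.Gamma (a / 2 + 1) := Real.Gamma_pos_of_pos (by linarith)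
  have hG2 : 0 < Real.Gamma ((a + 1) / 2) := Real.Gamma_pos_of_pos (by linarith)
  rw [lintegral_rpow_mul_exp_neg_mul_rpow two_pos ha one_pos, Real.one_rpow,
    ← ENNReal.ofReal_ofNat, ← ENNReal.ofReal_mul (by norm_num),
    ← ENNReal.ofReal_mul (by positivity)] at h
  have hne : ENNReal.ofReal (Real.Gamma (a / 2 + 1) / 2) ≠ 0 := by
    rw [ENNReal.ofReal_ne_zero_iff]; positivity
  rw [← ENNReal.mul_right_inj hne ENNReal.ofReal_ne_top, h, ← ENNReal.ofReal_mul (by positivity)]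
  congr 1
  rw [div_mul_div_cancel₀']
  · ring
  · exact hG.ne'

theorem absCosMoment_neg_one : absCosMoment (-1) = ⊤ := by
  have h := absCosMoment_mul (a := -1) (by norm_num)
  have htop : ∫⁻ x in Ioi (0 : ℝ), ENNReal.ofReal (x ^ (-1 : ℝ) * Real.exp (-1 * x ^ (2 : ℝ))) =
      ⊤ := by
    have h1 : ∫⁻ x in Ioo (0 : ℝ) 1, ENNReal.ofReal (x ^ (-1 : ℝ)) = ⊤ := by
      by_contra hne
      rw [← ne_eq, lintegral_ofReal_ne_top_iff_integrable (Measurable.aestronglyMeasurable (by fun_prop))]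
        at hne
      · exact absurd ((intervalIntegral.integrableOn_Ioo_rpow_iff one_pos).1 hne) (lt_irrefl _)
      · filter_upwards [ae_restrict_mem measurableSet_Ioo] with x hx
        exact Real.rpow_nonneg hx.1.le _
    have h2 : ∫⁻ x in Ioo (0 : ℝ) 1, ENNReal.ofReal (Real.exp (-1)) *
        ENNReal.ofReal (x ^ (-1 : ℝ)) = ⊤ := by
      rw [lintegral_const_mul' _ _ ENNReal.ofReal_ne_top, h1, ENNReal.mul_top]
      rw [ENNReal.ofReal_ne_zero_iff]
      exact Real.exp_pos _
    rw [eq_top_iff, ← h2]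
    refine (setLIntegral_mono' measurableSet_Ioo fun x hx => ?_).trans
      (lintegral_mono_set Ioo_subset_Ioi_self)
    rw [← ENNReal.ofReal_mul (Real.exp_pos _).le, mul_comm]
    have hx0 : 0 < x := hx.1
    refine ENNReal.ofReal_le_ofReal (mul_le_mul_of_nonneg_left ?_ (by positivity))
    rw [Real.exp_le_exp, Real.rpow_two]
    nlinarith [hx.1, hx.2]
  rw [htop, ENNReal.mul_top two_ne_zero, ENNReal.top_mul (by
    rw [ENNReal.ofReal_ne_zero_iff]; exact Real.sqrt_pos.2 Real.pi_pos)] at h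
  by_contra hne
  exact ENNReal.mul_ne_top ENNReal.ofReal_ne_top hne h

end PolarMoments

/-! ### Translates of the disc and the fractional integral identity -/

section Translation

open Set
open scoped ENNReal FourierTransform symmDiff

theorem enorm_sq_indicator_one_sub {α : Type*} (s : Set α) (x y : α) :
    ‖s.indicator (fun _ => (1 : ℂ)) x - s.indicator (fun _ => (1 : ℂ)) y‖ₑ ^ 2 =
      {p : α × α | (p.1 ∈ s ∧ p.2 ∉ s) ∨ (p.2 ∈ s ∧ p.1 ∉ s)}.indicator
        (fun _ => (1 : ℝ≥0∞)) (x, y) := by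
  by_cases hx : x ∈ s <;> by_cases hy : y ∈ s <;> simp [hx, hy]

theorem lintegral_enorm_sq_indicator_Icc_sub_translate {a s : ℝ} (ha : 0 ≤ a) (hs : 0 < s) :
    ∫⁻ x : ℝ, ‖(Icc (-a) a).indicator (fun _ => (1 : ℂ)) x -
      (Icc (-a) a).indicator (fun _ => (1 : ℂ)) (x + s)‖ₑ ^ 2 =
      ENNReal.ofReal (2 * min s (2 * a)) := by
  have h1 : ∀ x : ℝ, ‖(Icc (-a) a).indicator (fun _ => (1 : ℂ)) x -
      (Icc (-a) a).indicator (fun _ => (1 : ℂ)) (x + s)‖ₑ ^ 2 =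
      (Icc (-a) a ∆ Icc (-a - s) (a - s)).indicator 1 x := by
    intro x
    have hiff : x + s ∈ Icc (-a) a ↔ x ∈ Icc (-a - s) (a - s) := by
      simp only [mem_Icc, sub_le_iff_le_add, le_sub_iff_add_le]
    rw [enorm_sq_indicator_one_sub]
    by_cases hx : x ∈ Icc (-a) a <;> by_cases hy : x ∈ Icc (-a - s) (a - s) <;>
      simp only [indicator, mem_ofPred_eq, hx, hy, hiff, mem_symmDiff, Pi.one_apply]
  simp_rw [h1]
  rw [lintegral_indicator_one (measurableSet_Icc.symmDiff measurableSet_Icc),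
    measure_symmDiff_eq measurableSet_Icc.nullMeasurableSet measurableSet_Icc.nullMeasurableSet]
  rcases le_total s (2 * a) with h | h
  · have e1 : Icc (-a) a \ Icc (-a - s) (a - s) = Ioc (a - s) a := by
      ext x
      simp only [mem_sdiff, mem_Icc, mem_Ioc, not_and, not_le]
      constructor
      · rintro ⟨⟨h1, h2⟩, h3⟩
        exact ⟨h3 (by linarith), h2⟩
      · rintro ⟨h1, h2⟩
        exact ⟨⟨by linarith, h2⟩, fun _ => h1⟩
    have e2 : Icc (-a - s) (a - s) \ Icc (-a) a = Ico (-a - s) (-a) := by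
      ext x
      simp only [mem_sdiff, mem_Icc, mem_Ico, not_and, not_le]
      constructor
      · rintro ⟨⟨h1, h2⟩, h3⟩
        refine ⟨h1, ?_⟩
        by_contra hc
        linarith [h3 (not_lt.1 hc)]
      · rintro ⟨h1, h2⟩
        exact ⟨⟨h1, by linarith⟩, fun h => absurd h (not_le.2 h2)⟩
    rw [e1, e2, Real.volume_Ioc, Real.volume_Ico, min_eq_left h,
      ← ENNReal.ofReal_add (by linarith) (by linarith)]
    congr 1
    ring
  -- When s = 2a the closed intervals share the endpoint -a, so disjointness only covers s > 2a.
  · rcases h.eq_or_lt with h | h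
    · have e1 : Icc (-a) a \ Icc (-a - s) (a - s) = Ioc (-a) a := by
        ext x
        simp only [mem_sdiff, mem_Icc, mem_Ioc, not_and, not_le]
        constructor
        · rintro ⟨⟨h1, h2⟩, h3⟩
          exact ⟨by linarith [h3 (by linarith)], h2⟩
        · rintro ⟨h1, h2⟩
          exact ⟨⟨h1.le, h2⟩, fun _ => by linarith⟩
      have e2 : Icc (-a - s) (a - s) \ Icc (-a) a = Ico (-a - s) (a - s) := by
        ext x
        simp only [mem_sdiff, mem_Icc, mem_Ico, not_and, not_le]
        constructor
        · rintro ⟨⟨h1, h2⟩, h3⟩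
          refine ⟨h1, ?_⟩
          by_contra hc
          linarith [h3 (by linarith)]
        · rintro ⟨h1, h2⟩
          exact ⟨⟨h1, h2.le⟩, fun h => by linarith⟩
      rw [e1, e2, Real.volume_Ioc, Real.volume_Ico, ← h, min_self,
        ← ENNReal.ofReal_add (by linarith) (by linarith)]
      congr 1
      ring
    · have hd : Disjoint (Icc (-a) a) (Icc (-a - s) (a - s)) := by
        rw [Set.disjoint_left]
        intro x hx hx'
        linarith [hx.1, hx'.2]
      rw [hd.sdiff_eq_left, hd.sdiff_eq_right, Real.volume_Icc, Real.volume_Icc,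
        min_eq_right h.le, ← ENNReal.ofReal_add (by linarith) (by linarith)]
      congr 1
      ring

theorem lintegral_Ioi_rpow_neg_one_sub {c k : ℝ} (hc : 0 < c) (hk : 0 < k) :
    ∫⁻ s in Ioi c, ENNReal.ofReal (s ^ (-1 - k)) = ENNReal.ofReal (c ^ (-k) / k) := by
  rw [← ofReal_integral_eq_lintegral_ofReal (integrableOn_Ioi_rpow_of_lt (by linarith) hc),
    integral_Ioi_rpow_of_lt (by linarith) hc]
  · congr 1
    rw [show -1 - k + 1 = -k by ring, neg_div_neg_eq]
  · filter_upwards [ae_restrict_mem measurableSet_Ioi] with x hx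
    exact Real.rpow_nonneg (hc.trans hx).le _

/-- Layer cake: 2 min(s, 2a) is the integral over 0 < x ≤ a of 4 times the indicator of 2x < s.
After Tonelli, the integral of s^(-1-k) over s > 2x is (2x)^(-k)/k. -/
theorem lintegral_rpow_mul_min {a k : ℝ} (ha : 0 ≤ a) (hk : 0 < k) :
    ∫⁻ s in Ioi (0 : ℝ), ENNReal.ofReal (s ^ (-1 - k)) * ENNReal.ofReal (2 * min s (2 * a)) =
      ENNReal.ofReal (2 ^ (1 - k) / k) *
        ∫⁻ x : ℝ, (Icc (-a) a).indicator (fun x => ENNReal.ofReal (|x| ^ (-k))) x := by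
  have hR : ∫⁻ x : ℝ, (Icc (-a) a).indicator (fun x => ENNReal.ofReal (|x| ^ (-k))) x =
      2 * ∫⁻ x in Ioi (0 : ℝ), (Iic a).indicator (fun x => ENNReal.ofReal (x ^ (-k))) x := by
    rw [← lintegral_comp_abs]
    refine lintegral_congr fun x => ?_
    simp only [indicator, mem_Icc, mem_Iic, abs_le]
  have hL : ∀ s ∈ Ioi (0 : ℝ), ENNReal.ofReal (s ^ (-1 - k)) *
      ENNReal.ofReal (2 * min s (2 * a)) = ∫⁻ x in Ioi (0 : ℝ),
        (Iic a).indicator (fun _ => (4 : ℝ≥0∞)) x *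
          {p : ℝ × ℝ | 2 * p.2 < p.1}.indicator (fun p => ENNReal.ofReal (p.1 ^ (-1 - k)))
            (s, x) := by
    intro s hs
    have hs' : 0 < s := hs
    have e1 : ∀ x : ℝ, (Iic a).indicator (fun _ => (4 : ℝ≥0∞)) x *
          {p : ℝ × ℝ | 2 * p.2 < p.1}.indicator (fun p => ENNReal.ofReal (p.1 ^ (-1 - k)))
            (s, x) = (Iic a ∩ Iio (s / 2)).indicator
              (fun _ => 4 * ENNReal.ofReal (s ^ (-1 - k))) x := by
      intro x
      have : 2 * x < s ↔ x < s / 2 := by rw [lt_div_iff₀ two_pos, mul_comm]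
      by_cases h1 : x ≤ a <;> by_cases h2 : x < s / 2 <;> simp [indicator, h1, h2, this]
    simp_rw [e1]
    rw [setLIntegral_indicator (measurableSet_Iic.inter measurableSet_Iio), lintegral_const,
      Measure.restrict_apply_univ]
    have e2 : volume (Iic a ∩ Iio (s / 2) ∩ Ioi 0) = ENNReal.ofReal (min s (2 * a) / 2) := by
      rw [show Iic a ∩ Iio (s / 2) ∩ Ioi 0 = Ioi 0 ∩ Iic a ∩ Iio (s / 2) by
        ext; simp only [mem_inter_iff]; tauto, Ioi_inter_Iic]
      rcases le_total s (2 * a) with h | h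
      · rw [show Ioc 0 a ∩ Iio (s / 2) = Ioo 0 (s / 2) by
          ext x
          simp only [mem_inter_iff, mem_Ioc, mem_Iio, mem_Ioo]
          exact ⟨fun h => ⟨h.1.1, h.2⟩, fun h' => ⟨⟨h'.1, by linarith [h'.2]⟩, h'.2⟩⟩,
          Real.volume_Ioo, min_eq_left h, sub_zero]
      · refine le_antisymm ?_ ?_
        · refine (measure_mono inter_subset_left).trans ?_
          rw [Real.volume_Ioc, min_eq_right h]
          exact ENNReal.ofReal_le_ofReal (by linarith)
        · refine le_trans ?_ (measure_mono (s := Ioo 0 a) fun x hx =>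
            ⟨⟨hx.1, hx.2.le⟩, by simp only [mem_Iio]; linarith [hx.2]⟩)
          rw [Real.volume_Ioo, min_eq_right h]
          exact ENNReal.ofReal_le_ofReal (by linarith)
    have hm : 0 ≤ min s (2 * a) := le_min hs'.le (by linarith)
    rw [e2, mul_comm (4 : ℝ≥0∞), mul_assoc]
    congr 1
    rw [← ENNReal.ofReal_ofNat, ← ENNReal.ofReal_mul (by norm_num)]
    congr 1
    ring
  rw [setLIntegral_congr_fun measurableSet_Ioi hL, lintegral_lintegral_swap, hR, ← mul_assoc,
    ← lintegral_const_mul']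
  · refine setLIntegral_congr_fun measurableSet_Ioi fun x hx => ?_
    have hx' : 0 < x := hx
    have e3 : ∫⁻ s in Ioi (0 : ℝ), {p : ℝ × ℝ | 2 * p.2 < p.1}.indicator
        (fun p => ENNReal.ofReal (p.1 ^ (-1 - k))) (s, x) =
        ENNReal.ofReal ((2 * x) ^ (-k) / k) := by
      rw [← lintegral_Ioi_rpow_neg_one_sub (by positivity) hk,
        show Ioi (2 * x) = Ioi (2 * x) ∩ Ioi 0 by
          rw [Ioi_inter_Ioi, sup_eq_left.2 (by positivity)],
        ← setLIntegral_indicator measurableSet_Ioi]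
      rfl
    have hne : (Iic a).indicator (fun _ => (4 : ℝ≥0∞)) x ≠ ⊤ := by
      by_cases hxa : x ∈ Iic a <;> simp [hxa]
    rw [lintegral_const_mul' _ _ hne, e3]
    by_cases hxa : x ∈ Iic a
    · rw [indicator_of_mem hxa, indicator_of_mem hxa, ← ENNReal.ofReal_ofNat,
        ← ENNReal.ofReal_ofNat, ← ENNReal.ofReal_mul (by norm_num),
        ← ENNReal.ofReal_mul (by positivity), ← ENNReal.ofReal_mul (by positivity)]
      congr 1
      rw [Real.mul_rpow two_pos.le hx'.le, sub_eq_add_neg 1 k, Real.rpow_add two_pos, Real.rpow_one]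
      ring
    · simp [indicator_of_notMem hxa]
  · exact ENNReal.mul_ne_top ENNReal.ofReal_ne_top (by norm_num)
  · refine Measurable.aemeasurable (Measurable.mul ?_ ?_)
    · exact (measurable_const.indicator measurableSet_Iic).comp measurable_snd
    · exact Measurable.indicator (by fun_prop) (measurableSet_lt (by fun_prop) (by fun_prop))

theorem mk_mem_closedBall_iff {R x y : ℝ} (hR : 0 ≤ R) :
    (⟨x, y⟩ : ℂ) ∈ Metric.closedBall (0 : ℂ) R ↔
      y ^ 2 ≤ R ^ 2 ∧ x ∈ Icc (-Real.sqrt (R ^ 2 - y ^ 2)) (Real.sqrt (R ^ 2 - y ^ 2)) := by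
  rw [mem_closedBall_zero_iff, ← abs_of_nonneg (norm_nonneg (⟨x, y⟩ : ℂ)), ← abs_of_nonneg hR,
    ← sq_le_sq, abs_of_nonneg hR, Complex.sq_norm, Complex.normSq_mk, mem_Icc, ← abs_le]
  constructor
  · intro h
    exact ⟨by nlinarith [mul_self_nonneg x], Real.abs_le_sqrt (by linarith [sq x])⟩
  · rintro ⟨h1, h2⟩
    have h3 := pow_le_pow_left₀ (abs_nonneg x) h2 2
    rw [sq_abs, Real.sq_sqrt (by linarith)] at h3
    linarith [sq x, sq y]

/-- The fractional integral of the squared `L²` distance between the indicator of a disc and its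
horizontal translates. -/
theorem lintegral_rpow_mul_lintegral_disc_sub_translate {R k : ℝ} (hR : 0 ≤ R) (hk : 0 < k) :
    ∫⁻ s in Ioi (0 : ℝ), ENNReal.ofReal (s ^ (-1 - k)) *
      ∫⁻ z : ℂ, ‖(Metric.closedBall (0 : ℂ) R).indicator (fun _ => (1 : ℂ)) z -
        (Metric.closedBall (0 : ℂ) R).indicator (fun _ => (1 : ℂ)) (z + (s : ℂ))‖ₑ ^ 2 =
      ENNReal.ofReal (2 ^ (1 - k) / k) * ∫⁻ z : ℂ, (Metric.closedBall (0 : ℂ) R).indicator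
        (fun z => ENNReal.ofReal (|z.re| ^ (-k))) z := by
  have hmeas : Measurable ((Metric.closedBall (0 : ℂ) R).indicator (fun _ => (1 : ℂ))) :=
    measurable_const.indicator measurableSet_closedBall
  have h1 : ∀ s ∈ Ioi (0 : ℝ), ENNReal.ofReal (s ^ (-1 - k)) *
      ∫⁻ z : ℂ, ‖(Metric.closedBall (0 : ℂ) R).indicator (fun _ => (1 : ℂ)) z -
        (Metric.closedBall (0 : ℂ) R).indicator (fun _ => (1 : ℂ)) (z + (s : ℂ))‖ₑ ^ 2 =
      ∫⁻ y : ℝ, ENNReal.ofReal (s ^ (-1 - k)) *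
        ENNReal.ofReal (2 * min s (2 * Real.sqrt (R ^ 2 - y ^ 2))) := by
    intro s hs
    rw [lintegral_complex_eq (by fun_prop), lintegral_const_mul' _ _ ENNReal.ofReal_ne_top]
    congr 1
    refine lintegral_congr fun y => ?_
    rw [← lintegral_enorm_sq_indicator_Icc_sub_translate (Real.sqrt_nonneg _) hs]
    have hadd : ∀ x : ℝ, (⟨x, y⟩ : ℂ) + (s : ℂ) = ⟨x + s, y⟩ := fun x => by
      apply Complex.ext <;> simp
    simp_rw [hadd]
    by_cases hy : y ^ 2 ≤ R ^ 2
    · refine lintegral_congr fun x => ?_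
      simp only [indicator, mk_mem_closedBall_iff hR, hy, true_and]
    · have h0 : Real.sqrt (R ^ 2 - y ^ 2) = 0 := Real.sqrt_eq_zero_of_nonpos (by linarith)
      rw [lintegral_enorm_sq_indicator_Icc_sub_translate (Real.sqrt_nonneg _) hs, h0, mul_zero,
        min_eq_right (le_of_lt hs)]
      simp only [indicator, mk_mem_closedBall_iff hR, hy, false_and]
      simp
  rw [setLIntegral_congr_fun measurableSet_Ioi h1, lintegral_lintegral_swap
    (Measurable.aemeasurable (by fun_prop)), lintegral_complex_eq
    (Measurable.indicator (by fun_prop) measurableSet_closedBall),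
    ← lintegral_const_mul' _ _ ENNReal.ofReal_ne_top]
  refine lintegral_congr fun y => ?_
  rw [lintegral_rpow_mul_min (Real.sqrt_nonneg _) hk]
  congr 1
  refine lintegral_congr fun x => ?_
  by_cases hy : y ^ 2 ≤ R ^ 2
  · simp only [indicator, mk_mem_closedBall_iff hR, hy, true_and]
  · have h0 : Real.sqrt (R ^ 2 - y ^ 2) = 0 := Real.sqrt_eq_zero_of_nonpos (by linarith)
    simp only [indicator, mk_mem_closedBall_iff hR, hy, false_and, if_false, h0, neg_zero, Icc_self,
      mem_singleton_iff]
    -- On a line missing the disc the interval degenerates to {0}, where the integrand is zero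
    -- because `0 ^ (-k) = 0`.
    split_ifs with hx
    · simp [hx, Real.zero_rpow (neg_ne_zero.2 hk.ne')]
    · rfl

theorem enorm_sq_one_sub_fourierChar (x : ℝ) :
    ‖(1 : ℂ) - (Real.fourierChar x : ℂ)‖ₑ ^ 2 =
      ENNReal.ofReal (2 * (1 - Real.cos (2 * Real.pi * x))) := by
  rw [← ofReal_norm, ← ENNReal.ofReal_pow (norm_nonneg _), Complex.sq_norm,
    Real.fourierChar_apply]
  congr 1
  rw [Complex.normSq_apply]
  simp only [Complex.sub_re, Complex.sub_im, Complex.exp_ofReal_mul_I_re,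
    Complex.exp_ofReal_mul_I_im, Complex.one_re, Complex.one_im]
  linear_combination Real.sin_sq_add_cos_sq (2 * Real.pi * x)

/-- Translation by s multiplies the transform by a character, and |1 - exp(2πi s re z)|² = 2(1 -
cos(2π s re z)). -/
theorem lintegral_enorm_sq_sub_translate {f : ℂ → ℂ} (hf : Integrable f) (hf2 : MemLp f 2)
    (s : ℝ) :
    ∫⁻ z, ‖f z - f (z + (s : ℂ))‖ₑ ^ 2 =
      ∫⁻ z : ℂ, ENNReal.ofReal (2 * (1 - Real.cos (2 * Real.pi * (s * z.re)))) * ‖𝓕 f z‖ₑ ^ 2 := by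
  have hfs : Integrable fun z => f (z + (s : ℂ)) := hf.comp_add_right _
  have hfs2 : MemLp (fun z => f (z + (s : ℂ))) 2 :=
    hf2.comp_measurePreserving (measurePreserving_add_right volume (s : ℂ))
  have h := lintegral_enorm_sq_fourier (hf.sub hfs) (hf2.sub hfs2)
  simp only [Pi.sub_apply] at h
  rw [← h]
  refine lintegral_congr fun z => ?_
  have hF : 𝓕 (f - fun z => f (z + (s : ℂ))) z =
      (1 - (Real.fourierChar (s * z.re) : ℂ)) * 𝓕 f z := by
    have h1 : 𝓕 (fun z => f (z + (s : ℂ))) z =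
        (Real.fourierChar (s * z.re) : ℂ) * 𝓕 f z := by
      have := congrFun (VectorFourier.fourierIntegral_comp_add_right Real.fourierChar volume
        (innerₗ ℂ) f (s : ℂ)) z
      have hin : innerₗ ℂ (s : ℂ) z = s * z.re := by
        rw [innerₗ_apply_apply, Complex.inner]
        simp [mul_comm]
      rw [hin] at this
      exact this
    have h2 : 𝓕 (f - fun z => f (z + (s : ℂ))) z = 𝓕 f z - 𝓕 (fun z => f (z + (s : ℂ))) z := by
      simp only [Real.fourier_eq, Pi.sub_apply, smul_sub]
      exact integral_sub ((Real.fourierIntegral_convergent_iff z).2 hf)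
        ((Real.fourierIntegral_convergent_iff z).2 hfs)
    rw [h2, h1]
    ring
  rw [hF, enorm_mul, mul_pow, enorm_sq_one_sub_fourierChar]

/-- Integrate the Plancherel identity for f - f(· + s) against s^(-1-k). On the frequency side
Tonelli produces |re z|^k; on the space side the disc integral of |re z|^(-k) is evaluated in polar
coordinates. -/
theorem lintegral_fourier_disc_abs_re_rpow {R k : ℝ} (hR : 0 ≤ R) (hk0 : 0 < k) (hk2 : k < 2) :
    ENNReal.ofReal (2 * (2 * Real.pi) ^ k *
        (Real.Gamma (k / 2) * Real.Gamma (1 - k / 2) / (2 * Real.Gamma (1 + k)))) *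
      ∫⁻ z : ℂ, ‖𝓕 ((Metric.closedBall (0 : ℂ) R).indicator fun _ => (1 : ℂ)) z‖ₑ ^ 2 *
        ENNReal.ofReal (|z.re| ^ k) =
      ENNReal.ofReal (2 ^ (1 - k) / k) * (ENNReal.ofReal (R ^ (2 - k) / (2 - k)) *
        absCosMoment (-k)) := by
  have hfin : volume (Metric.closedBall (0 : ℂ) R) ≠ ⊤ := measure_closedBall_lt_top.ne
  have hcont : Continuous (𝓕 ((Metric.closedBall (0 : ℂ) R).indicator fun _ => (1 : ℂ))) :=
    continuous_fourier_indicator_one measurableSet_closedBall hfin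
  have h1 := lintegral_rpow_mul_lintegral_disc_sub_translate hR hk0
  simp_rw [lintegral_enorm_sq_sub_translate ((integrable_indicator_iff
    (measurableSet_closedBall (x := (0 : ℂ)) (ε := R))).2 (integrableOn_const hfin (C := (1 : ℂ))))
    (memLp_indicator_const 2 measurableSet_closedBall (1 : ℂ) (Or.inr hfin))] at h1
  have h2 : ∫⁻ z : ℂ, (Metric.closedBall (0 : ℂ) R).indicator
      (fun z => ENNReal.ofReal (|z.re| ^ (-k))) z =
      ENNReal.ofReal (R ^ (2 - k) / (2 - k)) * absCosMoment (-k) := by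
    have h3 := lintegral_radial_mul_abs_re_rpow (F := (Iic R).indicator 1)
      (measurable_const.indicator measurableSet_Iic) (-k)
    have h4 : ∫⁻ r in Ioi (0 : ℝ), ENNReal.ofReal (r ^ (1 + -k)) * (Iic R).indicator 1 r =
        ENNReal.ofReal (R ^ (2 - k) / (2 - k)) := by
      have : ∀ r : ℝ, ENNReal.ofReal (r ^ (1 + -k)) * (Iic R).indicator 1 r =
          (Iic R).indicator (fun r => ENNReal.ofReal (r ^ (1 + -k))) r := fun r => by
        by_cases hr : r ∈ Iic R <;> simp [hr]
      simp_rw [this]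
      rw [setLIntegral_indicator measurableSet_Iic, inter_comm, Ioi_inter_Iic,
        ← ofReal_integral_eq_lintegral_ofReal, ← intervalIntegral.integral_of_le hR,
        integral_rpow (Or.inl (by linarith)), Real.zero_rpow (by linarith), sub_zero]
      · congr 2
        · ring_nf
        · ring
      · exact (intervalIntegrable_iff_integrableOn_Ioc_of_le hR).1
          (intervalIntegral.intervalIntegrable_rpow' (by linarith))
      · filter_upwards [ae_restrict_mem measurableSet_Ioc] with x hx
        exact Real.rpow_nonneg hx.1.le _
    rw [h4] at h3
    rw [← h3]
    refine lintegral_congr fun z => ?_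
    by_cases hz : ‖z‖ ≤ R <;> simp [indicator, hz]
  rw [← h2, ← h1]
  simp_rw [← lintegral_const_mul' _ _ ENNReal.ofReal_ne_top]
  rw [lintegral_lintegral_swap]
  · refine lintegral_congr fun z => ?_
    have h5 : ∀ s : ℝ, ENNReal.ofReal (s ^ (-1 - k)) *
        (ENNReal.ofReal (2 * (1 - Real.cos (2 * Real.pi * (s * z.re)))) *
          ‖𝓕 ((Metric.closedBall (0 : ℂ) R).indicator fun _ => (1 : ℂ)) z‖ₑ ^ 2) =
        ENNReal.ofReal ((1 - Real.cos ((2 * Real.pi * z.re) * s)) * s ^ (-1 - k)) *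
          (2 * ‖𝓕 ((Metric.closedBall (0 : ℂ) R).indicator fun _ => (1 : ℂ)) z‖ₑ ^ 2) := by
      intro s
      rw [ENNReal.ofReal_mul two_pos.le, ENNReal.ofReal_mul (sub_nonneg.2 (Real.cos_le_one _)),
        show 2 * Real.pi * z.re * s = 2 * Real.pi * (s * z.re) by ring, ENNReal.ofReal_ofNat]
      ring
    simp_rw [h5]
    rw [lintegral_mul_const _ (by fun_prop), lintegral_one_sub_cos_const_mul_rpow hk0 hk2, abs_mul,
      abs_of_pos Real.two_pi_pos, Real.mul_rpow Real.two_pi_pos.le (abs_nonneg _),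
      ENNReal.ofReal_mul (by positivity), ENNReal.ofReal_mul (by positivity),
      ENNReal.ofReal_mul (by positivity), ENNReal.ofReal_ofNat]
    ring
  · have := hcont.measurable
    exact Measurable.aemeasurable (by fun_prop)

end Translation

/-! ### Moments of the squared profile -/

section DiscMoments

open Set
open scoped ENNReal FourierTransform

/-- The closed form of the `k`-th moment. -/
noncomputable def discMoment (k : ℝ) : ℝ :=
  Real.Gamma (1 + k / 2) * Real.Gamma (1 - k) /
    (Real.Gamma (2 - k / 2) * Real.Gamma (1 - k / 2) ^ 2)

theorem discMoment_pos {k : ℝ} (h1 : -2 < k) (h2 : k < 1) : 0 < discMoment k := by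
  have := Real.Gamma_pos_of_pos (show 0 < 1 + k / 2 by linarith)
  have := Real.Gamma_pos_of_pos (show 0 < 1 - k by linarith)
  have := Real.Gamma_pos_of_pos (show 0 < 2 - k / 2 by linarith)
  have := Real.Gamma_pos_of_pos (show 0 < 1 - k / 2 by linarith)
  rw [discMoment]
  positivity

theorem enorm_discProfile_norm (z : ℂ) :
    ‖discProfile ‖z‖‖ₑ =
      ‖𝓕 ((Metric.closedBall (0 : ℂ) Real.pi⁻¹).indicator fun _ => (1 : ℂ)) z‖ₑ := by
  rw [fourier_disc_eq_discProfile]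

/-- The profile is even, by w ↦ -w, so it is the restriction of the continuous transform of the disc
to the real axis. -/
theorem continuous_discProfile : Continuous discProfile := by
  have heq : ∀ t : ℝ, discProfile t = discProfile ‖(t : ℂ)‖ := by
    intro t
    rw [Complex.norm_real, Real.norm_eq_abs]
    rcases abs_choice t with h | h
    · rw [h]
    · rw [h, discProfile, discProfile,
        ← (Measure.measurePreserving_neg (volume : Measure ℂ)).setIntegral_preimage_emb
        (MeasurableEquiv.neg ℂ).measurableEmbedding]
      simp
  have : discProfile = fun t : ℝ =>
      𝓕 ((Metric.closedBall (0 : ℂ) Real.pi⁻¹).indicator fun _ => (1 : ℂ)) (t : ℂ) :=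
    funext fun t => (heq t).trans (fourier_disc_eq_discProfile _).symm
  rw [this]
  exact (continuous_fourier_indicator_one measurableSet_closedBall
    measure_closedBall_lt_top.ne).comp Complex.continuous_ofReal

theorem lintegral_discProfile_mul_rpow_mul {k : ℝ} (hk0 : 0 < k) (hk2 : k < 2) :
    ENNReal.ofReal (2 * (2 * Real.pi) ^ k *
        (Real.Gamma (k / 2) * Real.Gamma (1 - k / 2) / (2 * Real.Gamma (1 + k)))) *
      (absCosMoment k * ∫⁻ z : ℂ, ‖discProfile ‖z‖‖ₑ ^ 2 * ENNReal.ofReal (‖z‖ ^ k)) =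
    ENNReal.ofReal (2 * Real.pi) * (ENNReal.ofReal (2 ^ (1 - k) / k) *
      (ENNReal.ofReal (Real.pi⁻¹ ^ (2 - k) / (2 - k)) * absCosMoment (-k))) := by
  have h := lintegral_fourier_disc_abs_re_rpow (R := Real.pi⁻¹) (by positivity) hk0 hk2
  simp_rw [← enorm_discProfile_norm] at h
  rw [← h, ← lintegral_radial_mul_abs_re_rpow_eq (F := fun r => ‖discProfile r‖ₑ ^ 2)
    (by have := continuous_discProfile.measurable; fun_prop)]
  ring

theorem lintegral_discProfile_mul_rpow {k : ℝ} (hk0 : 0 < k) (hk1 : k < 1) :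
    ENNReal.ofReal Real.pi * ∫⁻ z : ℂ, ‖discProfile ‖z‖‖ₑ ^ 2 * ENNReal.ofReal (‖z‖ ^ k) =
      ENNReal.ofReal (discMoment k) := by
  have h := lintegral_discProfile_mul_rpow_mul hk0 (by linarith)
  have ha := Real.Gamma_pos_of_pos (show 0 < k / 2 by linarith)
  have hb := Real.Gamma_pos_of_pos (show 0 < (k + 1) / 2 by linarith)
  have hc := Real.Gamma_pos_of_pos (show 0 < (1 - k) / 2 by linarith)
  have hd := Real.Gamma_pos_of_pos (show 0 < 1 - k / 2 by linarith)
  have he := Real.Gamma_pos_of_pos (show 0 < 1 + k / 2 by linarith)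
  have hf := Real.Gamma_pos_of_pos hk0
  have hpi := Real.pi_pos
  have hsq : Real.sqrt Real.pi ^ 2 = Real.pi := Real.sq_sqrt hpi.le
  have hs : 0 < Real.sqrt Real.pi := Real.sqrt_pos.2 hpi
  have h2k : 0 < 2 - k := by linarith
  have hP : 0 < (2 : ℝ) ^ k := by positivity
  have hQ : 0 < Real.pi ^ k := by positivity
  have e1 : Real.Gamma (1 + k) = k * Real.Gamma k := by rw [add_comm, Real.Gamma_add_one hk0.ne']
  have e2 : Real.Gamma (2 - k / 2) = (1 - k / 2) * Real.Gamma (1 - k / 2) := by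
    rw [show 2 - k / 2 = 1 - k / 2 + 1 by ring, Real.Gamma_add_one (by linarith)]
  -- Legendre duplication at k/2 here, and at (1 - k)/2 in `e4`.
  have e3 : Real.Gamma (k / 2) * Real.Gamma ((k + 1) / 2) * 2 ^ k =
      2 * Real.Gamma k * Real.sqrt Real.pi := by
    have := Real.Gamma_mul_Gamma_add_half (k / 2)
    rw [show k / 2 + 1 / 2 = (k + 1) / 2 by ring, show 2 * (k / 2) = k by ring,
      Real.rpow_sub two_pos, Real.rpow_one] at this
    rw [this]
    field_simp
  have e4 : Real.Gamma ((1 - k) / 2) * Real.Gamma (1 - k / 2) =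
      Real.Gamma (1 - k) * 2 ^ k * Real.sqrt Real.pi := by
    have := Real.Gamma_mul_Gamma_add_half ((1 - k) / 2)
    rw [show (1 - k) / 2 + 1 / 2 = 1 - k / 2 by ring, show 2 * ((1 - k) / 2) = 1 - k by ring,
      show 1 - (1 - k) = k by ring] at this
    exact this
  have e5 : (2 : ℝ) ^ (1 - k) = 2 / 2 ^ k := by rw [Real.rpow_sub two_pos, Real.rpow_one]
  have e6 : Real.pi⁻¹ ^ (2 - k) = Real.pi ^ k / Real.pi ^ 2 := by
    rw [Real.inv_rpow hpi.le, ← Real.rpow_neg hpi.le, neg_sub, Real.rpow_sub hpi, Real.rpow_two]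
  have e7 : (2 * Real.pi) ^ k = 2 ^ k * Real.pi ^ k := Real.mul_rpow two_pos.le hpi.le
  rw [absCosMoment_eq (by linarith), absCosMoment_eq (by linarith), ← mul_assoc,
    show k / 2 + 1 = 1 + k / 2 by ring, show -k / 2 + 1 = 1 - k / 2 by ring,
    show (-k + 1) / 2 = (1 - k) / 2 by ring, e1, e5, e6, e7] at h
  rw [← ENNReal.ofReal_mul (by positivity), ← ENNReal.ofReal_mul (by positivity),
    ← ENNReal.ofReal_mul (by positivity), ← ENNReal.ofReal_mul (by positivity)] at h
  set c := 2 * (2 ^ k * Real.pi ^ k) * (Real.Gamma (k / 2) * Real.Gamma (1 - k / 2) /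
    (2 * (k * Real.Gamma k))) *
    (2 * Real.sqrt Real.pi * Real.Gamma ((k + 1) / 2) / Real.Gamma (1 + k / 2)) with hcdef
  have hcpos : 0 < c := by positivity
  have hcne : ENNReal.ofReal c ≠ 0 := ENNReal.ofReal_ne_zero_iff.2 hcpos
  rw [← ENNReal.mul_right_inj hcne ENNReal.ofReal_ne_top, mul_left_comm, h,
    ← ENNReal.ofReal_mul hpi.le, ← ENNReal.ofReal_mul hcpos.le, hcdef, discMoment, e2]
  congr 1
  have e3' : Real.Gamma k = Real.Gamma (k / 2) * Real.Gamma ((k + 1) / 2) * 2 ^ k /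
      (2 * Real.sqrt Real.pi) := by
    rw [e3]
    field_simp
  have e4' : Real.Gamma (1 - k) = Real.Gamma ((1 - k) / 2) * Real.Gamma (1 - k / 2) /
      (2 ^ k * Real.sqrt Real.pi) := by
    rw [e4]
    field_simp
  have e8 : 1 - k / 2 = (2 - k) / 2 := by ring
  rw [e8] at hd
  rw [e3', e4', e8]
  field_simp

/-- At k = 1 the right side of the moment identity contains the infinite cosine moment of order -1,
while the constants on the left are finite. -/
theorem lintegral_discProfile_mul_norm :
    ENNReal.ofReal Real.pi * ∫⁻ z : ℂ, ‖discProfile ‖z‖‖ₑ ^ 2 * ENNReal.ofReal (‖z‖ ^ (1 : ℝ)) =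
      ⊤ := by
  have h := lintegral_discProfile_mul_rpow_mul one_pos one_lt_two
  have h1 : absCosMoment 1 ≠ ⊤ := by
    rw [absCosMoment_eq (by norm_num)]
    exact ENNReal.ofReal_ne_top
  have hpi := Real.pi_pos
  have h2 : ENNReal.ofReal (2 * Real.pi) * (ENNReal.ofReal (2 ^ ((1 : ℝ) - 1) / 1) *
      (ENNReal.ofReal (Real.pi⁻¹ ^ ((2 : ℝ) - 1) / (2 - 1)) * absCosMoment (-1))) = ⊤ := by
    rw [absCosMoment_neg_one, ENNReal.mul_top, ENNReal.mul_top, ENNReal.mul_top] <;>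
    rw [ENNReal.ofReal_ne_zero_iff]
    · positivity
    · positivity
    · norm_num; positivity
  rw [h2] at h
  by_contra hne
  have h3 : ∫⁻ z : ℂ, ‖discProfile ‖z‖‖ₑ ^ 2 * ENNReal.ofReal (‖z‖ ^ (1 : ℝ)) ≠ ⊤ := by
    intro htop
    rw [htop, ENNReal.mul_top (ENNReal.ofReal_ne_zero_iff.2 hpi)] at hne
    exact hne rfl
  exact ENNReal.mul_ne_top ENNReal.ofReal_ne_top (ENNReal.mul_ne_top h1 h3) h

theorem enorm_discProfile_le (t : ℝ) : ‖discProfile t‖ₑ ≤ ENNReal.ofReal (1 / Real.pi) := by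
  rw [← ofReal_norm]
  refine ENNReal.ofReal_le_ofReal ?_
  rw [discProfile]
  refine (norm_setIntegral_le_of_norm_le_const (C := 1) measure_closedBall_lt_top
    fun w _ => ?_).trans ?_
  · rw [show 2 * (Real.pi : ℂ) * Complex.I * ((t * w.re : ℝ) : ℂ) =
      ((2 * Real.pi * (t * w.re) : ℝ) : ℂ) * Complex.I by push_cast; ring,
      Complex.norm_exp_ofReal_mul_I]
  · rw [one_mul, Measure.real, Complex.volume_closedBall]
    have := Real.pi_pos
    simp [ENNReal.toReal_ofReal, this.le]
    field_simp
    exact le_rfl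

theorem lintegral_discProfile :
    ENNReal.ofReal Real.pi * ∫⁻ z : ℂ, ‖discProfile ‖z‖‖ₑ ^ 2 ≠ ⊤ := by
  simp_rw [enorm_discProfile_norm]
  rw [lintegral_enorm_sq_fourier_indicator_one measurableSet_closedBall
    measure_closedBall_lt_top.ne]
  exact ENNReal.mul_ne_top ENNReal.ofReal_ne_top measure_closedBall_lt_top.ne

/-- In the unit disc the profile is bounded and r^(1+k) is integrable because k > -2; outside it
‖z‖^k ≤ 1 and the profile is square integrable. -/
theorem lintegral_discProfile_mul_rpow_ne_top_of_nonpos {k : ℝ} (hk : -2 < k) (hk0 : k ≤ 0) :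
    ENNReal.ofReal Real.pi *
      ∫⁻ z : ℂ, ‖discProfile ‖z‖‖ₑ ^ 2 * ENNReal.ofReal (‖z‖ ^ k) ≠ ⊤ := by
  have h1 : ∫⁻ z : ℂ, (Iic (1 : ℝ)).indicator (fun r => ENNReal.ofReal (r ^ k)) ‖z‖ ≠ ⊤ := by
    rw [lintegral_radial ((by fun_prop : Measurable fun r : ℝ => ENNReal.ofReal (r ^ k)).indicator
      measurableSet_Iic)]
    refine ENNReal.mul_ne_top ?_ ENNReal.ofReal_ne_top
    have h2 : ∀ r : ℝ, ENNReal.ofReal r * (Iic (1 : ℝ)).indicator (fun r => ENNReal.ofReal (r ^ k)) r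
        = (Iic (1 : ℝ)).indicator (fun r => ENNReal.ofReal r * ENNReal.ofReal (r ^ k)) r := by
      intro r
      by_cases hr : r ∈ Iic (1 : ℝ) <;> simp [hr]
    simp_rw [h2]
    rw [setLIntegral_indicator measurableSet_Iic, inter_comm, Ioi_inter_Iic]
    have h3 : ∀ r ∈ Ioc (0 : ℝ) 1, ENNReal.ofReal r * ENNReal.ofReal (r ^ k) =
        ENNReal.ofReal (r ^ (1 + k)) := by
      intro r hr
      rw [← ENNReal.ofReal_mul hr.1.le, Real.rpow_add hr.1, Real.rpow_one]
    rw [setLIntegral_congr_fun measurableSet_Ioc h3]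
    have h4 : IntegrableOn (fun r : ℝ => r ^ (1 + k)) (Ioc 0 1) :=
      (intervalIntegrable_iff_integrableOn_Ioc_of_le zero_le_one).1
          (intervalIntegral.intervalIntegrable_rpow' (by linarith))
    exact (h4.lintegral_lt_top).ne
  have hC : ENNReal.ofReal (1 / Real.pi) ^ 2 ≠ ⊤ := ENNReal.pow_ne_top ENNReal.ofReal_ne_top
  have h5 : ∫⁻ z : ℂ, ‖discProfile ‖z‖‖ₑ ^ 2 ≠ ⊤ := by
    intro h
    have := lintegral_discProfile
    rw [h, ENNReal.mul_top (ENNReal.ofReal_ne_zero_iff.2 Real.pi_pos)] at this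
    exact this rfl
  refine ENNReal.mul_ne_top ENNReal.ofReal_ne_top (ne_top_of_le_ne_top
    (ENNReal.add_ne_top.2 ⟨ENNReal.mul_ne_top hC h1, h5⟩) ?_)
  have hm : Measurable fun z : ℂ => ‖discProfile ‖z‖‖ₑ ^ 2 := by
    have := continuous_discProfile.measurable
    fun_prop
  rw [← lintegral_const_mul' _ _ hC, ← lintegral_add_right _ hm]
  refine lintegral_mono fun z => ?_
  by_cases hz : ‖z‖ ≤ 1
  · refine le_add_right ?_
    rw [indicator_of_mem (mem_Iic.2 hz)]
    gcongr
    exact enorm_discProfile_le _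
  · refine le_add_left ?_
    refine mul_le_of_le_one_right' ?_
    rw [ENNReal.ofReal_le_one]
    exact Real.rpow_le_one_of_one_le_of_nonpos (not_le.1 hz).le hk0

theorem lintegral_discProfile_mul_rpow_ne_top {k : ℝ} (hk : -2 < k) (hk1 : k < 1) :
    ENNReal.ofReal Real.pi *
      ∫⁻ z : ℂ, ‖discProfile ‖z‖‖ₑ ^ 2 * ENNReal.ofReal (‖z‖ ^ k) ≠ ⊤ := by
  rcases le_or_gt k 0 with h | h
  · exact lintegral_discProfile_mul_rpow_ne_top_of_nonpos hk h
  · rw [lintegral_discProfile_mul_rpow h hk1]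
    exact ENNReal.ofReal_ne_top

theorem Real.analyticAt_Gamma {x : ℝ} (hx : 0 < x) : AnalyticAt ℝ Real.Gamma x := by
  have h : AnalyticAt ℂ Complex.Gamma (x : ℂ) := by
    refine DifferentiableOn.analyticAt (s := {s : ℂ | 0 < s.re}) (fun s hs => ?_)
      ((isOpen_lt continuous_const Complex.continuous_re).mem_nhds (by simpa using hx))
    refine (Complex.differentiableAt_Gamma s fun m h => ?_).differentiableWithinAt
    have hs' : 0 < s.re := hs
    rw [h] at hs'
    simp only [Complex.neg_re, Complex.natCast_re] at hs'
    linarith [(Nat.cast_nonneg m : (0 : ℝ) ≤ m)]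
  exact h.re_ofReal

theorem analyticOnNhd_discMoment : AnalyticOnNhd ℝ discMoment (Ioo (-2) 1) := by
  intro k hk
  have a1 : AnalyticAt ℝ (fun k : ℝ => Real.Gamma (1 + k / 2)) k :=
    (Real.analyticAt_Gamma (by linarith [hk.1])).fun_comp (f := fun k : ℝ => 1 + k / 2) (by fun_prop)
  have a2 : AnalyticAt ℝ (fun k : ℝ => Real.Gamma (1 - k)) k :=
    (Real.analyticAt_Gamma (by linarith [hk.2])).fun_comp (f := fun k : ℝ => 1 - k) (by fun_prop)
  have a3 : AnalyticAt ℝ (fun k : ℝ => Real.Gamma (2 - k / 2)) k :=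
    (Real.analyticAt_Gamma (by linarith [hk.2])).fun_comp (f := fun k : ℝ => 2 - k / 2) (by fun_prop)
  have a4 : AnalyticAt ℝ (fun k : ℝ => Real.Gamma (1 - k / 2)) k :=
    (Real.analyticAt_Gamma (by linarith [hk.2])).fun_comp (f := fun k : ℝ => 1 - k / 2) (by fun_prop)
  have := Real.Gamma_pos_of_pos (show 0 < 2 - k / 2 by linarith [hk.2])
  have := Real.Gamma_pos_of_pos (show 0 < 1 - k / 2 by linarith [hk.2])
  exact (a1.mul a2).div (a3.mul (a4.pow 2)) (by positivity)

end DiscMoments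

/-! ### Transfer to a random variable and analytic continuation -/

section Law

open Set ProbabilityTheory
open scoped ENNReal

variable {Ω : Type*} [MeasurableSpace Ω] {P : Measure Ω}
  {Z : Ω → EuclideanSpace ℝ (Fin 2)} {u : EuclideanSpace ℝ (Fin 2)}

theorem lintegral_comp_norm_sub_of_hasLaw
    (hZ : HasLaw Z (volume.withDensity fun v => ENNReal.ofReal (ballDensity 2 u v)) P)
    {g : ℝ → ℝ≥0∞} (hg : Measurable g) :
    ∫⁻ ω, g ‖Z ω - u‖ ∂P =
      ENNReal.ofReal Real.pi * ∫⁻ z : ℂ, ‖discProfile ‖z‖‖ₑ ^ 2 * g ‖z‖ := by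
  have hm := continuous_discProfile.measurable
  have hd : ∀ v, ENNReal.ofReal (ballDensity 2 u v) =
      ENNReal.ofReal Real.pi * ‖discProfile ‖v - u‖‖ₑ ^ 2 := fun v => by
    rw [ofReal_ballDensity, ballKernel_two_eq_discProfile]
  have hgm : Measurable fun v => g ‖v - u‖ := by fun_prop
  rw [← lintegral_map' (f := fun v => g ‖v - u‖) hgm.aemeasurable hZ.aemeasurable, hZ.map_eq]
  simp_rw [hd]
  rw [lintegral_withDensity_eq_lintegral_mul _ (by fun_prop) hgm,
    ← lintegral_const_mul' _ _ ENNReal.ofReal_ne_top]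
  simp only [Pi.mul_apply, mul_assoc]
  rw [lintegral_sub_right_eq_self (fun v : EuclideanSpace ℝ (Fin 2) =>
      ENNReal.ofReal Real.pi * (‖discProfile ‖v‖‖ₑ ^ 2 * g ‖v‖)) u,
    ← (Complex.orthonormalBasisOneI.repr.measurePreserving).lintegral_comp_emb
      Complex.orthonormalBasisOneI.repr.toHomeomorph.measurableEmbedding]
  simp_rw [LinearIsometryEquiv.norm_map]

/-- Needed to write r^k as exp(k log r): since `Real.log 0 = 0`, this fails at r = 0 for k ≠ 0. -/
theorem ae_norm_sub_pos_of_hasLaw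
    (hZ : HasLaw Z (volume.withDensity fun v => ENNReal.ofReal (ballDensity 2 u v)) P) :
    ∀ᵐ ω ∂P, 0 < ‖Z ω - u‖ := by
  have h := lintegral_comp_norm_sub_of_hasLaw hZ (g := ({0} : Set ℝ).indicator 1)
    (measurable_const.indicator (measurableSet_singleton 0))
  have h0 : ∫⁻ z : ℂ, ‖discProfile ‖z‖‖ₑ ^ 2 * ({0} : Set ℝ).indicator 1 ‖z‖ = 0 := by
    rw [← lintegral_zero (μ := (volume : Measure ℂ))]
    refine lintegral_congr_ae ?_
    filter_upwards [compl_mem_ae_iff.2 (measure_singleton (0 : ℂ))] with z hz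
    have : ‖z‖ ∉ ({0} : Set ℝ) := by simpa using hz
    rw [indicator_of_notMem this, mul_zero]
  have hm := hZ.aemeasurable
  have hg : Measurable (({0} : Set ℝ).indicator (1 : ℝ → ℝ≥0∞)) :=
    measurable_const.indicator (measurableSet_singleton 0)
  rw [h0, mul_zero, lintegral_eq_zero_iff' (hg.comp_aemeasurable'
    (f := fun ω => ‖Z ω - u‖) (by fun_prop))] at h
  filter_upwards [h] with ω hω
  refine (norm_nonneg _).lt_of_ne' fun hne => ?_
  simp [hne] at hω

theorem integrable_norm_sub_rpow_of_hasLaw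
    (hZ : HasLaw Z (volume.withDensity fun v => ENNReal.ofReal (ballDensity 2 u v)) P)
    {k : ℝ} (hk : -2 < k) (hk1 : k < 1) : Integrable (fun ω => ‖Z ω - u‖ ^ k) P := by
  have hm := hZ.aemeasurable
  rw [← lintegral_ofReal_ne_top_iff_integrable
    (AEMeasurable.aestronglyMeasurable (by fun_prop))
    (Filter.Eventually.of_forall fun ω => Real.rpow_nonneg (norm_nonneg _) _),
    lintegral_comp_norm_sub_of_hasLaw hZ (g := fun r => ENNReal.ofReal (r ^ k)) (by fun_prop)]
  exact lintegral_discProfile_mul_rpow_ne_top hk hk1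

theorem exp_mul_log_norm_sub_ae_eq
    (hZ : HasLaw Z (volume.withDensity fun v => ENNReal.ofReal (ballDensity 2 u v)) P) (k : ℝ) :
    (fun ω => Real.exp (k * Real.log ‖Z ω - u‖)) =ᵐ[P] fun ω => ‖Z ω - u‖ ^ k := by
  filter_upwards [ae_norm_sub_pos_of_hasLaw hZ] with ω hω
  rw [Real.rpow_def_of_pos hω, mul_comm]

/-- The moments of the distance, continued analytically from `0 < k < 1`, where they are known. -/
theorem integral_norm_sub_rpow_of_hasLaw
    (hZ : HasLaw Z (volume.withDensity fun v => ENNReal.ofReal (ballDensity 2 u v)) P)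
    {k : ℝ} (hk : -2 < k) (hk1 : k < 1) : ∫ ω, ‖Z ω - u‖ ^ k ∂P = discMoment k := by
  have hm := hZ.aemeasurable
  have hmgf : ∀ k, mgf (fun ω => Real.log ‖Z ω - u‖) P k = ∫ ω, ‖Z ω - u‖ ^ k ∂P := fun k =>
    integral_congr_ae (exp_mul_log_norm_sub_ae_eq hZ k)
  have hsub : Ioo (-2 : ℝ) 1 ⊆
      interior (integrableExpSet (fun ω => Real.log ‖Z ω - u‖) P) := by
    refine interior_maximal (fun k hk => ?_) isOpen_Ioo
    exact (integrable_norm_sub_rpow_of_hasLaw hZ hk.1 hk.2).congr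
      (exp_mul_log_norm_sub_ae_eq hZ k).symm
  -- Any point of (0, 1) would do as base point: the closed form is known there, and both sides are
  -- analytic on the connected interval (-2, 1).
  have heq : mgf (fun ω => Real.log ‖Z ω - u‖) P =ᶠ[nhds (1 / 2)] discMoment := by
    filter_upwards [Ioo_mem_nhds (show (0 : ℝ) < 1 / 2 by norm_num)
      (show (1 / 2 : ℝ) < 1 by norm_num)] with k hk
    rw [hmgf, integral_eq_lintegral_of_nonneg_ae
      (Filter.Eventually.of_forall fun ω => Real.rpow_nonneg (norm_nonneg _) _)
      (AEMeasurable.aestronglyMeasurable (by fun_prop)),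
      lintegral_comp_norm_sub_of_hasLaw hZ (g := fun r => ENNReal.ofReal (r ^ k)) (by fun_prop),
      lintegral_discProfile_mul_rpow hk.1 hk.2, ENNReal.toReal_ofReal
        (discMoment_pos (by linarith [hk.1]) hk.2).le]
  rw [← hmgf]
  exact (analyticOnNhd_mgf.mono hsub).eqOn_of_preconnected_of_eventuallyEq
    analyticOnNhd_discMoment isPreconnected_Ioo (by norm_num) heq ⟨hk, hk1⟩

theorem lintegral_norm_sub_rpow_of_hasLaw [IsProbabilityMeasure P]
    (hZ : HasLaw Z (volume.withDensity fun v => ENNReal.ofReal (ballDensity 2 u v)) P)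
    {k : ℝ} (hk : 1 ≤ k) : ∫⁻ ω, ENNReal.ofReal (‖Z ω - u‖ ^ k) ∂P = ⊤ := by
  have h1 : ∫⁻ ω, ENNReal.ofReal (‖Z ω - u‖ ^ (1 : ℝ)) ∂P = ⊤ := by
    rw [lintegral_comp_norm_sub_of_hasLaw hZ (g := fun r => ENNReal.ofReal (r ^ (1 : ℝ)))
      (by fun_prop), lintegral_discProfile_mul_norm]
  by_contra hne
  -- For k ≥ 1, r ≤ 1 + r^k, and the constant 1 has finite integral under a probability measure.
  have h2 : ∫⁻ ω, ENNReal.ofReal (‖Z ω - u‖ ^ (1 : ℝ)) ∂P ≤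
      ∫⁻ ω, (1 + ENNReal.ofReal (‖Z ω - u‖ ^ k)) ∂P := by
    refine lintegral_mono fun ω => ?_
    rcases le_total ‖Z ω - u‖ 1 with h | h
    · refine le_add_right ?_
      rw [ENNReal.ofReal_le_one]
      simpa using h
    · exact le_add_left (ENNReal.ofReal_le_ofReal (Real.rpow_le_rpow_of_exponent_le h hk))
  rw [lintegral_add_left measurable_const, h1, lintegral_one, measure_univ] at h2
  exact ENNReal.add_ne_top.2 ⟨ENNReal.one_ne_top, hne⟩ (top_le_iff.1 h2)

end Law

theorem proposition1 :
    (∀ d : ℕ, 1 ≤ d →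
      IsGloballyMostRepulsive (ballKernel d) ∧
      ∀ u : EuclideanSpace ℝ (Fin d),
        ballKernel d u u = ((1 / Real.pi : ℝ) : ℂ) ∧
        (∀ v, pushedOutIntensity (ballKernel d) u v = ballDensity d u v) ∧
        IsProbabilityDensity (ballDensity d u)) ∧
    (∀ u : EuclideanSpace ℝ (Fin 2),
      (∀ v, v ≠ u →
        ballDensity 2 u v = besselJ 1 (2 * ‖v - u‖) ^ 2 / (Real.pi * ‖v - u‖ ^ 2)) ∧
      ballDensity 2 u u = 1 / Real.pi ∧
      ∀ (Ω : Type*) [MeasurableSpace Ω] (P : Measure Ω) [IsProbabilityMeasure P]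
        (Z : Ω → EuclideanSpace ℝ (Fin 2)),
        ProbabilityTheory.HasLaw Z
          (volume.withDensity (fun v => ENNReal.ofReal (ballDensity 2 u v))) P →
        (∀ k : ℝ, -2 < k → k < 1 →
          Integrable (fun ω => ‖Z ω - u‖ ^ k) P ∧
          ∫ ω, ‖Z ω - u‖ ^ k ∂P =
            Real.Gamma (1 + k / 2) * Real.Gamma (1 - k) /
              (Real.Gamma (2 - k / 2) * Real.Gamma (1 - k / 2) ^ 2)) ∧
        (∀ k : ℝ, 1 ≤ k → ∫⁻ ω, ENNReal.ofReal (‖Z ω - u‖ ^ k) ∂P = ⊤)) := by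
  refine ⟨fun d hd => ⟨isGloballyMostRepulsive_ballKernel hd, fun u => ⟨ballKernel_self hd u,
    pushedOutIntensity_ballKernel hd u, isProbabilityDensity_ballDensity hd u⟩⟩, fun u =>
    ⟨fun v hv => ballDensity_two_of_ne hv, ballDensity_self one_le_two u, ?_⟩⟩
  intro Ω _ P _ Z hZ
  exact ⟨fun k hk hk1 => ⟨integrable_norm_sub_rpow_of_hasLaw hZ hk hk1,
    integral_norm_sub_rpow_of_hasLaw hZ hk hk1⟩, fun k hk => lintegral_norm_sub_rpow_of_hasLaw hZ hk⟩
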